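/- Let $S^3\subset\mathbb R^4$ be the standard unit sphere with surface measure $\mu$ and Laplace–Beltrami operator $\Delta$ (with nonpositive spectrum), and let $$P\varphi=\Delta^2\varphi+\tfrac12\Delta\varphi-\tfrac{15}{16}\varphi$$ be the Paneitz operator. For $\varepsilon\in\mathbb R$, a Green's function of $P+\varepsilon$ is a continuous function $G$ on $S^3\times S^3$ with $$\int_{S^3}G(x,y)\,(P\varphi+\varepsilon\varphi)(y)\,d\mu(y)=\varphi(x)\qquad\text{for all }\varphi\in C^\infty(S^3),\ x\in S^3 .$$ For functions $k_1,k_2$ on $[-1,1]$ let $(k_1*k_2)(t)=\int_{S^3}k_1(x\cdot y)\,k_2(y\cdot z)\,d\mu(y)$, where $x,z\in S^3$ are any points with $x\cdot z=t$, and let $k^{*(j+1)}=k*\cdots*k$ ($j+1$ factors). Put $$k(t)=\frac{\sqrt{1-t}}{4\sqrt2\,\pi},\qquad t\in[-1,1].$$ There is $\varepsilon_0>0$ such that for every $\varepsilon\in(0,\varepsilon_0)$ the following holds. The operator $P+\varepsilon$ has exactly one Green's function $G_{P+\varepsilon}$; there is a function $k_\varepsilon$ on $[-1,1]$ with $$k_\varepsilon(x\cdot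 y)=-G_{P+\varepsilon}(x,y)\quad\text{for all }x,y\in S^3;$$ it is given by the convergent series $$k_\varepsilon(t)=\sum_{j=0}^\infty\varepsilon^j\,k^{*(j+1)}(t),\qquad t\in[-1,1];$$ and $k_\varepsilon$ is strictly decreasing on $[-1,1]$. -/

import Mathlib

open MeasureTheory Metric Set
open scoped Manifold ContDiff InnerProductSpace Laplacian Pointwise

noncomputable section

namespace PaneitzSphere

/-- The Euclidean space `ℝ⁴`. -/
abbrev R4 : Type := EuclideanSpace ℝ (Fin 4)

/-- The standard three sphere, the unit sphere of `ℝ⁴`. -/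
abbrev S3 : Type := sphere (0 : R4) 1

/-- The Riemannian volume measure of the standard `S³`: the surface measure induced by Lebesgue
measure of `ℝ⁴` (total mass `4 · vol(B⁴) = 2π²`). -/
abbrev sphereMeasure : Measure S3 := (volume : Measure R4).toSphere

/-- The extension of a function on `S³` to `ℝ⁴ ∖ {0}` that is homogeneous of degree `0`:
`x ↦ f (x / ‖x‖)` (with the irrelevant value `0` at the origin). -/
def homExt (f : S3 → ℝ) (x : R4) : ℝ :=
  open Classical in
  if h : x ≠ 0 then f ⟨‖x‖⁻¹ • x, by simp [norm_smul, h]⟩ else 0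

/-- The Laplace–Beltrami operator of the standard `S³` (with nonpositive spectrum): the restriction
to `S³` of the Laplacian in `ℝ⁴` of the degree `0` homogeneous extension. -/
def sphereLaplacian (f : S3 → ℝ) (p : S3) : ℝ := (Δ (homExt f)) (p : R4)

/-- The Paneitz operator `P φ = Δ² φ + (1/2) Δ φ - (15/16) φ` on the standard `S³`. -/
def paneitz (φ : S3 → ℝ) (p : S3) : ℝ :=
  sphereLaplacian (sphereLaplacian φ) p + 1 / 2 * sphereLaplacian φ p - 15 / 16 * φ p

/-- `G` is the (continuous) Green's function on `S³` of the formally self-adjoint operator `A`: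
for each `x`, `A (G (x, ·)) = δ_x` in the sense of distributions, that is,
`∫ G (x, y) (A φ) (y) dμ(y) = φ (x)` for all `φ ∈ C^∞(S³)`. -/
structure IsGreenFunction (A : (S3 → ℝ) → (S3 → ℝ)) (G : S3 → S3 → ℝ) : Prop where
  continuous : Continuous (Function.uncurry G)
  integral_eq : ∀ φ : S3 → ℝ, ContMDiff (𝓡 3) 𝓘(ℝ, ℝ) ∞ φ →
    ∀ x : S3, ∫ y, G x y * A φ y ∂sphereMeasure = φ x

/-- The profile `k(t) = √(1 - t) / (4 √2 π)`. -/
def kProfile (t : ℝ) : ℝ := √(1 - t) / (4 * √2 * Real.pi)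

/-- The north pole `(0, 0, 0, 1)`. -/
def northPole : R4 := !₂[0, 0, 0, 1]

/-- For `t ∈ [-1, 1]`, a point of `S³` whose inner product with the north pole is `t`. -/
def pointAt (t : ℝ) : R4 := !₂[√(1 - t ^ 2), 0, 0, t]

/-- The convolution of two functions on `[-1, 1]`:
`(k₁ * k₂)(t) = ∫_{S³} k₁ (x · y) k₂ (y · z) dμ(y)` for `x, z ∈ S³` with `x · z = t`.
It does not depend on the choice of `x` and `z`, see `conv_inner`. -/
def conv (k₁ k₂ : ℝ → ℝ) (t : ℝ) : ℝ :=
  ∫ y : S3, k₁ ⟪northPole, (y : R4)⟫_ℝ * k₂ ⟪(y : R4), pointAt t⟫_ℝ ∂sphereMeasure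

/-- `convPow k j` is the convolution `k * ⋯ * k` with `j + 1` factors. -/
def convPow (k : ℝ → ℝ) : ℕ → ℝ → ℝ
  | 0 => k
  | j + 1 => conv k (convPow k j)

/-- The action of an orthogonal transformation on `S³`. -/
def rot (R : R4 ≃ₗᵢ[ℝ] R4) (y : S3) : S3 := ⟨R y, by simp⟩

theorem rot_measurePreserving (R : R4 ≃ₗᵢ[ℝ] R4) :
    MeasurePreserving (rot R) sphereMeasure sphereMeasure := by
  have hm : Measurable (rot R) :=
    (Continuous.subtype_mk (R.continuous.comp continuous_subtype_val) _).measurable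
  refine ⟨hm, ?_⟩
  ext s hs
  rw [Measure.map_apply hm hs, Measure.toSphere_apply' _ (hm hs), Measure.toSphere_apply' _ hs]
  congr 1
  have key : Ioo (0 : ℝ) 1 • ((fun y : S3 => (y : R4)) '' (rot R ⁻¹' s)) =
      R ⁻¹' (Ioo (0 : ℝ) 1 • ((fun y : S3 => (y : R4)) '' s)) := by
    ext v
    simp only [Set.mem_smul, Set.mem_image, Set.mem_preimage]
    constructor
    · rintro ⟨r, hr, w, ⟨y, hy, rfl⟩, rfl⟩
      exact ⟨r, hr, R y, ⟨rot R y, hy, rfl⟩, by simp⟩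
    · rintro ⟨r, hr, w, ⟨y, hy, rfl⟩, h⟩
      refine ⟨r, hr, R.symm y, ⟨rot R.symm y, ?_, rfl⟩, ?_⟩
      · have : rot R (rot R.symm y) = y := Subtype.ext (by simp [rot])
        rwa [this]
      · apply R.injective
        simpa using h
  rw [key]
  exact R.measurePreserving.measure_preimage_equiv (f := R.toMeasurableEquiv) _

/-- The orthogonal group acts transitively on pairs of unit vectors with given inner product. -/
theorem exists_rot {x z x' z' : R4} (hx : ‖x‖ = 1) (hz : ‖z‖ = 1) (hx' : ‖x'‖ = 1) (hz' : ‖z'‖ = 1)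
    (h : ⟪x, z⟫_ℝ = ⟪x', z'⟫_ℝ) : ∃ R : R4 ≃ₗᵢ[ℝ] R4, R x = x' ∧ R z = z' := by
  let R₁ : R4 ≃ₗᵢ[ℝ] R4 := (ℝ ∙ (x - x'))ᗮ.reflection
  have h₁ : R₁ x = x' := Submodule.reflection_sub (by rw [hx, hx'])
  let R₂ : R4 ≃ₗᵢ[ℝ] R4 := (ℝ ∙ (R₁ z - z'))ᗮ.reflection
  have h₂ : R₂ (R₁ z) = z' := Submodule.reflection_sub (by simp [hz, hz'])
  have h₃ : R₂ x' = x' := by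
    apply Submodule.reflection_mem_subspace_eq_self
    rw [Submodule.mem_orthogonal_singleton_iff_inner_right, inner_sub_left, real_inner_comm x' z',
      ← h, real_inner_comm x', ← h₁, R₁.inner_map_map, sub_self]
  exact ⟨R₁.trans R₂, by simp [h₁, h₃], by simp [h₂]⟩

/-- The convolution is the profile of the convolution of the two invariant kernels. -/
theorem conv_inner (k₁ k₂ : ℝ → ℝ) (x z : S3) :
    conv k₁ k₂ ⟪(x : R4), (z : R4)⟫_ℝ =
      ∫ y : S3, k₁ ⟪(x : R4), (y : R4)⟫_ℝ * k₂ ⟪(y : R4), (z : R4)⟫_ℝ ∂sphereMeasure := by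
  set t : ℝ := ⟪(x : R4), (z : R4)⟫_ℝ with ht
  have hx : ‖(x : R4)‖ = 1 := by simp
  have hz : ‖(z : R4)‖ = 1 := by simp
  have ht1 : t ^ 2 ≤ 1 := by
    have := abs_real_inner_le_norm (x : R4) (z : R4)
    rw [hx, hz, one_mul] at this
    exact (sq_le_one_iff_abs_le_one _).2 this
  have hn : ‖northPole‖ = 1 := by simp [northPole, EuclideanSpace.norm_eq, Fin.sum_univ_four]
  have hp : ‖pointAt t‖ = 1 := by
    simp [pointAt, EuclideanSpace.norm_eq, Fin.sum_univ_four,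
      Real.sq_sqrt (show 0 ≤ 1 - t ^ 2 by linarith)]
  obtain ⟨R, hRx, hRz⟩ := exists_rot hx hz hn hp
    (by simp [northPole, pointAt, PiLp.inner_apply, Fin.sum_univ_four, ← ht])
  have he : MeasurableEmbedding (rot R) :=
    (Continuous.subtype_mk (R.continuous.comp continuous_subtype_val) _).measurableEmbedding
      fun a b hab => Subtype.ext (R.injective (congrArg Subtype.val hab))
  rw [conv, ← (rot_measurePreserving R).integral_comp he]
  simp only [rot, ← hRx, ← hRz, R.inner_map_map]

end PaneitzSphere

end

open PaneitzSphere

/-!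
Write `K` for the integral operator with kernel `k (x · y)`. Replacing `√(1 - t)` by `√(c - t)` with
`c > 1` regularises `k` to a smooth zonal function, whose image under `P` is an explicit multiple of
`-(c - a · y) ^ (-7/2)`; as `c ↓ 1` this is minus an approximate identity at `a`, so `K P = -1`.
Since `k ≥ 0` has total mass `16/15`, the operator `ε K` is a contraction in the supremum norm for
`|ε| < 15/16`; this gives the convergence of the Neumann series, and, applied to fixed points of
`ε K`, both the Green's function property and uniqueness.

The kernel `k (x · y) = |x - y| / (8π)` is Lipschitz in the chordal distance. Strict monotonicity
needs more, since near `x = ±y` the distance is of the order of the square root of the variation of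
`t = x · y`: by a reflection argument, the convolution of two Lipschitz zonal kernels is Lipschitz
in `t` itself. So the tail of the Neumann series is Lipschitz in `t` with small constant, while `k`
decreases at rate at least `1 / (16π)`.
-/

open Filter Topology

noncomputable section

namespace PaneitzSphere

section Laplacian

variable {E : Type*} [NormedAddCommGroup E] [InnerProductSpace ℝ E]

theorem hasFDerivAt_fderiv {f : E → ℝ} {x : E} (hf : ContDiffAt ℝ 2 f x) :
    HasFDerivAt (fderiv ℝ f) (fderiv ℝ (fderiv ℝ f) x) x :=
  ((hf.fderiv_right (m := 1) (by norm_num)).differentiableAt (by norm_num)).hasFDerivAt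

theorem eventually_hasFDerivAt {f : E → ℝ} {x : E} (hf : ContDiffAt ℝ 2 f x) :
    ∀ᶠ y in 𝓝 x, HasFDerivAt f (fderiv ℝ f y) y :=
  (hf.eventually (by simp)).mono fun _ hy => (hy.differentiableAt (by norm_num)).hasFDerivAt

variable [FiniteDimensional ℝ E]

theorem laplacian_congr {f g : E → ℝ} {x : E} (h : f =ᶠ[𝓝 x] g) : Δ f x = Δ g x :=
  (InnerProductSpace.laplacian_congr_nhds h).eq_of_nhds

theorem laplacian_eq_sum {ι : Type*} [Fintype ι] (b : OrthonormalBasis ι ℝ E) {f : E → ℝ} {x : E}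
    {f'' : E →L[ℝ] E →L[ℝ] ℝ} (hf : HasFDerivAt (fderiv ℝ f) f'' x) :
    Δ f x = ∑ i, f'' (b i) (b i) := by
  simp [InnerProductSpace.laplacian_eq_iteratedFDeriv_orthonormalBasis f b,
    iteratedFDeriv_two_apply, hf.fderiv]

theorem sum_fderiv_mul_fderiv {ι : Type*} [Fintype ι] (b : OrthonormalBasis ι ℝ E) (f g : E → ℝ)
    (x : E) : ∑ i, fderiv ℝ f x (b i) * fderiv ℝ g x (b i) = ⟪gradient f x, gradient g x⟫_ℝ := by
  rw [← b.sum_inner_mul_inner]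
  simp [inner_gradient_left, inner_gradient_right]

theorem laplacian_comp {F F' : ℝ → ℝ} {F'' : ℝ} {u : E → ℝ} {x : E}
    (hF : ∀ᶠ s in 𝓝 (u x), HasDerivAt F (F' s) s) (hF' : HasDerivAt F' F'' (u x))
    (hu : ContDiffAt ℝ 2 u x) :
    Δ (fun y => F (u y)) x = F'' * ‖gradient u x‖ ^ 2 + F' (u x) * Δ u x := by
  have hfderiv : fderiv ℝ (fun y => F (u y)) =ᶠ[𝓝 x] fun y => F' (u y) • fderiv ℝ u y := by
    filter_upwards [hu.continuousAt.eventually hF, eventually_hasFDerivAt hu] with y hy hy'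
    exact (hy.comp_hasFDerivAt y hy').fderiv
  have hF'u := hF'.comp_hasFDerivAt x (hu.differentiableAt (by norm_num)).hasFDerivAt
  have hsecond := (hF'u.smul (hasFDerivAt_fderiv hu)).congr_of_eventuallyEq hfderiv
  let b := stdOrthonormalBasis ℝ E
  rw [laplacian_eq_sum b hsecond, laplacian_eq_sum b (hasFDerivAt_fderiv hu),
    ← real_inner_self_eq_norm_sq, ← sum_fderiv_mul_fderiv b, Finset.mul_sum, Finset.mul_sum,
    ← Finset.sum_add_distrib]
  refine Finset.sum_congr rfl fun i _ => ?_
  simp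
  ring

theorem laplacian_mul {f g : E → ℝ} {x : E} (hf : ContDiffAt ℝ 2 f x) (hg : ContDiffAt ℝ 2 g x) :
    Δ (fun y => f y * g y) x =
      f x * Δ g x + g x * Δ f x + 2 * ⟪gradient f x, gradient g x⟫_ℝ := by
  have hfderiv : fderiv ℝ (fun y => f y * g y) =ᶠ[𝓝 x]
      fun y => f y • fderiv ℝ g y + g y • fderiv ℝ f y := by
    filter_upwards [eventually_hasFDerivAt hf, eventually_hasFDerivAt hg] with y hy hy'
    exact (hy.mul hy').fderiv
  have hsecond := (((hf.differentiableAt (by norm_num)).hasFDerivAt.smul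
    (hasFDerivAt_fderiv hg)).add ((hg.differentiableAt (by norm_num)).hasFDerivAt.smul
    (hasFDerivAt_fderiv hf))).congr_of_eventuallyEq hfderiv
  let b := stdOrthonormalBasis ℝ E
  rw [laplacian_eq_sum b hsecond, laplacian_eq_sum b (hasFDerivAt_fderiv hf),
    laplacian_eq_sum b (hasFDerivAt_fderiv hg), ← sum_fderiv_mul_fderiv b, Finset.mul_sum,
    Finset.mul_sum, Finset.mul_sum, ← Finset.sum_add_distrib, ← Finset.sum_add_distrib]
  refine Finset.sum_congr rfl fun i _ => ?_
  simp
  ring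

theorem laplacian_comp_smul {f : E → ℝ} {x : E} (r : ℝ) (hf : ContDiffAt ℝ 2 f (r • x)) :
    Δ (fun y => f (r • y)) x = r ^ 2 * Δ f (r • x) := by
  have hfderiv : fderiv ℝ (fun y => f (r • y)) = fun y => r • fderiv ℝ f (r • y) :=
    funext fun y => fderiv_comp_smul r
  have hsmul : HasFDerivAt (fun y : E => r • y) (r • ContinuousLinearMap.id ℝ E) x :=
    (hasFDerivAt_id x).const_smul r
  have hsecond := (((hasFDerivAt_fderiv hf).comp x hsmul).const_smul r).congr_of_eventuallyEq
    (Eventually.of_forall (congrFun hfderiv))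
  let b := stdOrthonormalBasis ℝ E
  rw [laplacian_eq_sum b hsecond, laplacian_eq_sum b (hasFDerivAt_fderiv hf),
    Finset.mul_sum]
  refine Finset.sum_congr rfl fun i _ => ?_
  simp
  ring

theorem contDiffAt_laplacian {f : E → ℝ} {x : E} (hf : ContDiffAt ℝ ∞ f x) :
    ContDiffAt ℝ ∞ (Δ f) x := by
  let b := stdOrthonormalBasis ℝ E
  have hsum : ContDiffAt ℝ ∞ (fun y => ∑ i, fderiv ℝ (fderiv ℝ f) y (b i) (b i)) x :=
    ContDiffAt.sum fun i _ => (((hf.fderiv_right (m := ∞) le_rfl).fderiv_right (m := ∞) le_rfl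
      ).clm_apply contDiffAt_const).clm_apply contDiffAt_const
  have hf2 : ContDiffAt ℝ 2 f x := hf.of_le (WithTop.coe_le_coe.2 le_top)
  refine hsum.congr_of_eventuallyEq ?_
  filter_upwards [hf2.eventually (by simp)] with y hy
  exact laplacian_eq_sum b (hasFDerivAt_fderiv hy)

theorem laplacian_inner (a x : E) : Δ (fun y => ⟪a, y⟫_ℝ) x = 0 := by
  have hfderiv : fderiv ℝ (fun y => ⟪a, y⟫_ℝ) = fun _ => innerSL ℝ a :=
    funext fun y => (innerSL ℝ a).hasFDerivAt.fderiv
  rw [laplacian_eq_sum (stdOrthonormalBasis ℝ E) (hfderiv ▸ hasFDerivAt_const _ x)]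
  simp

theorem gradient_norm_sq (x : E) : gradient (fun y : E => ‖y‖ ^ 2) x = (2 : ℝ) • x := by
  refine ext_inner_right ℝ fun v => ?_
  simp [inner_gradient_left, inner_smul_left]

theorem laplacian_norm_sq (x : E) :
    Δ (fun y : E => ‖y‖ ^ 2) x = 2 * Module.finrank ℝ E := by
  have hfderiv : fderiv ℝ (fun y : E => ‖y‖ ^ 2) = ⇑((2 : ℝ) • innerSL ℝ (E := E)) := by
    ext y v
    simp
  let b := stdOrthonormalBasis ℝ E
  rw [laplacian_eq_sum b (hfderiv ▸ ContinuousLinearMap.hasFDerivAt _)]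
  change ∑ i, 2 * ⟪b i, b i⟫_ℝ = _
  simp [mul_comm]

theorem gradient_comp {F : ℝ → ℝ} {F' : ℝ} {u : E → ℝ} {x : E} (hF : HasDerivAt F F' (u x))
    (hu : DifferentiableAt ℝ u x) : gradient (fun y => F (u y)) x = F' • gradient u x := by
  refine ext_inner_right ℝ fun v => ?_
  have h := (hF.comp_hasFDerivAt x hu.hasFDerivAt).fderiv
  rw [Function.comp_def] at h
  rw [inner_gradient_left, h, inner_smul_left, inner_gradient_left]
  rfl

theorem gradient_mul {f g : E → ℝ} {x : E} (hf : DifferentiableAt ℝ f x)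
    (hg : DifferentiableAt ℝ g x) :
    gradient (fun y => f y * g y) x = f x • gradient g x + g x • gradient f x := by
  refine ext_inner_right ℝ fun v => ?_
  rw [inner_gradient_left, fderiv_fun_mul hf hg]
  simp [inner_add_left, inner_smul_left, inner_gradient_left]

theorem gradient_inner (a x : E) : gradient (fun y => ⟪a, y⟫_ℝ) x = a :=
  HasGradientAt.gradient (show HasFDerivAt _ _ _ from (innerSL ℝ a).hasFDerivAt)

end Laplacian

section HomogeneousExtension

theorem coe_ne_zero (p : S3) : (p : R4) ≠ 0 := ne_zero_of_mem_unit_sphere p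

theorem norm_coe (p : S3) : ‖(p : R4)‖ = 1 := by simp

/-- The radial projection of `ℝ⁴ ∖ {0}` onto the sphere. -/
def toS3 (x : R4) (hx : x ≠ 0) : S3 := ⟨‖x‖⁻¹ • x, by simp [norm_smul, hx]⟩

theorem homExt_of_ne {f : S3 → ℝ} {x : R4} (hx : x ≠ 0) : homExt f x = f (toS3 x hx) := by
  simp [homExt, hx, toS3]

theorem homExt_coe (f : S3 → ℝ) (p : S3) : homExt f p = f p := by
  rw [homExt_of_ne (coe_ne_zero p)]
  congr 1
  exact Subtype.ext (by simp [toS3])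

theorem homExt_smul (f : S3 → ℝ) {r : ℝ} (hr : 0 < r) (x : R4) :
    homExt f (r • x) = homExt f x := by
  by_cases hx : x = 0
  · simp [hx]
  · rw [homExt_of_ne hx, homExt_of_ne (smul_ne_zero hr.ne' hx)]
    congr 1
    refine Subtype.ext ?_
    simp only [toS3, norm_smul, Real.norm_eq_abs, abs_of_pos hr, smul_smul]
    congr 1
    field_simp

theorem eventually_ne_zero (p : S3) : ∀ᶠ x in 𝓝 (p : R4), x ≠ 0 :=
  isOpen_compl_singleton.mem_nhds (coe_ne_zero p)

theorem sphereLaplacian_eq_of_homExt {f : S3 → ℝ} {F : R4 → ℝ} (h : ∀ x ≠ 0, homExt f x = F x)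
    (p : S3) : sphereLaplacian f p = Δ F (p : R4) :=
  laplacian_congr ((eventually_ne_zero p).mono h)

theorem sphereLaplacian_const (c : ℝ) : sphereLaplacian (fun _ => c) = fun _ => 0 := by
  funext p
  rw [sphereLaplacian_eq_of_homExt (F := fun _ => c) (fun x hx => homExt_of_ne hx)]
  simp

end HomogeneousExtension

section Smooth

/-- The space `C^∞(S³)`. -/
abbrev Smooth (f : S3 → ℝ) : Prop := ContMDiff (𝓡 3) 𝓘(ℝ, ℝ) ∞ f

instance : Fact (Module.finrank ℝ R4 = 3 + 1) := ⟨finrank_euclideanSpace_fin⟩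

theorem Smooth.of_contDiffAt {F : R4 → ℝ} (hF : ∀ p : S3, ContDiffAt ℝ ∞ F p) :
    Smooth (fun p => F p) := fun p =>
  (hF p).contMDiffAt.comp p (contMDiff_coe_sphere p)

theorem contDiffAt_homExt {f : S3 → ℝ} (hf : Smooth f) {x : R4} (hx : x ≠ 0) :
    ContDiffAt ℝ ∞ (homExt f) x := by
  let U : TopologicalSpace.Opens R4 := ⟨{0}ᶜ, isOpen_compl_singleton⟩
  have hnormalize : ContMDiff 𝓘(ℝ, R4) 𝓘(ℝ, R4) ∞ (fun y : U => ‖(y : R4)‖⁻¹ • (y : R4)) :=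
    fun y => (contMDiffAt_subtype_iff (f := fun x : R4 => ‖x‖⁻¹ • x)).2
      (((contDiffAt_norm ℝ y.2).inv (norm_ne_zero_iff.2 y.2)).smul contDiffAt_id).contMDiffAt
  have hmem (y : U) : ‖(y : R4)‖⁻¹ • (y : R4) ∈ sphere (0 : R4) 1 := (toS3 y y.2).2
  have hcomp : (f ∘ Set.codRestrict _ _ hmem : U → ℝ) = fun y : U => homExt f y :=
    funext fun y => (homExt_of_ne y.2).symm
  have hsmooth := hf.comp (hnormalize.codRestrict_sphere (n := 3) hmem)
  rw [hcomp] at hsmooth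
  exact ((contMDiffAt_subtype_iff (f := homExt f)).1 (hsmooth ⟨x, hx⟩)).contDiffAt

theorem contDiffAt_two_homExt {f : S3 → ℝ} (hf : Smooth f) {x : R4} (hx : x ≠ 0) :
    ContDiffAt ℝ 2 (homExt f) x :=
  (contDiffAt_homExt hf hx).of_le (WithTop.coe_le_coe.2 le_top)

theorem Smooth.sphereLaplacian {f : S3 → ℝ} (hf : Smooth f) : Smooth (sphereLaplacian f) :=
  .of_contDiffAt fun p => contDiffAt_laplacian (contDiffAt_homExt hf (coe_ne_zero p))

theorem Smooth.paneitz {f : S3 → ℝ} (hf : Smooth f) : Smooth (paneitz f) :=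
  (hf.sphereLaplacian.sphereLaplacian.add (contMDiff_const.mul hf.sphereLaplacian)).sub
    (contMDiff_const.mul hf)

theorem inner_self_gradient_homExt {f : S3 → ℝ} (hf : Smooth f) {x : R4} (hx : x ≠ 0) :
    ⟪x, gradient (homExt f) x⟫_ℝ = 0 := by
  have hray : HasDerivAt (fun r : ℝ => r • x) x 1 := by
    simpa using (hasDerivAt_id (1 : ℝ)).smul_const x
  have hdiff : HasFDerivAt (homExt f) (fderiv ℝ (homExt f) x) ((1 : ℝ) • x) := by
    rw [one_smul]
    exact ((contDiffAt_homExt hf hx).differentiableAt (by simp)).hasFDerivAt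
  have hconst : HasDerivAt (homExt f ∘ fun r : ℝ => r • x) 0 1 := by
    refine (hasDerivAt_const (1 : ℝ) (homExt f x)).congr_of_eventuallyEq ?_
    filter_upwards [lt_mem_nhds (zero_lt_one : (0 : ℝ) < 1)] with r hr
    exact homExt_smul f hr x
  rw [real_inner_comm, inner_gradient_left]
  exact (hdiff.comp_hasDerivAt (1 : ℝ) hray).unique hconst

theorem laplacian_homExt_smul {f : S3 → ℝ} (hf : Smooth f) {r : ℝ} (hr : 0 < r) {x : R4}
    (hx : x ≠ 0) : Δ (homExt f) (r • x) = (r ^ 2)⁻¹ * Δ (homExt f) x := by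
  have h := laplacian_comp_smul r (contDiffAt_two_homExt hf (smul_ne_zero hr.ne' hx))
  simp only [homExt_smul f hr] at h
  rw [h]
  field_simp

end Smooth

section SelfAdjoint

theorem integrable_sphereMeasure {f : S3 → ℝ} (hf : Continuous f) : Integrable f sphereMeasure :=
  hf.integrable_of_hasCompactSupport (HasCompactSupport.of_compactSpace f)

theorem integral_mul_laplacian_sub_eq_zero {E : Type*} [NormedAddCommGroup E]
    [InnerProductSpace ℝ E] [FiniteDimensional ℝ E] [MeasurableSpace E] [BorelSpace E]
    {f g : E → ℝ} (hf : ContDiff ℝ ∞ f) (hf' : HasCompactSupport f) (hg : ContDiff ℝ ∞ g)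
    (hg' : HasCompactSupport g) : ∫ x, (f x * Δ g x - Δ f x * g x) = 0 := by
  have hcont {h : E → ℝ} (hh : ContDiff ℝ ∞ h) : Continuous (Δ h) :=
    continuous_iff_continuousAt.2 fun _ => (contDiffAt_laplacian hh.contDiffAt).continuousAt
  have hparts := SchwartzMap.integral_mul_laplacian_right_eq_left (μ := volume)
    (hf'.toSchwartzMap hf) (hg'.toSchwartzMap hg)
  simp only [SchwartzMap.laplacian_apply] at hparts
  exact (integral_sub
    ((hf.continuous.mul (hcont hg)).integrable_of_hasCompactSupport hf'.mul_right)
    (((hcont hf).mul hg.continuous).integrable_of_hasCompactSupport hg'.mul_left)).trans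
    (sub_eq_zero.2 hparts)

theorem integral_polar (ψ : ℝ → ℝ) (w : R4 → ℝ)
    (hw : ∀ (r : ℝ) (p : S3), 0 < r → w (r • (p : R4)) = (r ^ 2)⁻¹ * w p) :
    ∫ x, ψ ‖x‖ * w x = (∫ p : S3, w p ∂sphereMeasure) *
      ∫ r : Ioi (0 : ℝ), ψ r * ((r : ℝ) ^ 2)⁻¹ ∂.volumeIoiPow (Module.finrank ℝ R4 - 1) := by
  have hprod := (volume : Measure R4).measurePreserving_homeomorphUnitSphereProd.integral_comp
    (Homeomorph.measurableEmbedding _)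
    (fun q : S3 × Ioi (0 : ℝ) => w q.1 * (ψ q.2 * ((q.2 : ℝ) ^ 2)⁻¹))
  rw [integral_prod_mul (fun p : S3 => w p) fun r : Ioi (0 : ℝ) => ψ r * ((r : ℝ) ^ 2)⁻¹] at hprod
  rw [← restrict_compl_singleton (μ := (volume : Measure R4)) 0, ← hprod,
    ← integral_subtype_comap (measurableSet_singleton (0 : R4)).compl (fun x => ψ ‖x‖ * w x)]
  refine integral_congr_ae (.of_forall fun x => ?_)
  have hx : (0 : ℝ) < ‖(x : R4)‖ := norm_pos_iff.2 x.2
  have hpolar : (x : R4) = ‖(x : R4)‖ • ((homeomorphUnitSphereProd R4 x).1 : R4) := by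
    simp [homeomorphUnitSphereProd_apply_fst_coe, smul_smul, hx.ne']
  have hwx := hw _ (homeomorphUnitSphereProd R4 x).1 hx
  rw [← hpolar] at hwx
  simp only [homeomorphUnitSphereProd_apply_snd_coe, hwx]
  ring

/-- A smooth function on `ℝ`, equal to `1` near `1` and supported in `(0, 2)`; composed with
`‖·‖ ^ 2` it localizes functions on `ℝ⁴ ∖ {0}` to a spherical shell. -/
def cutoff : ContDiffBump (1 : ℝ) := ⟨1 / 4, 1 / 2, by norm_num, by norm_num⟩

theorem cutoff_eq_zero {t : ℝ} (ht : 1 / 2 ≤ |t - 1|) : cutoff t = 0 :=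
  cutoff.zero_of_le_dist ht

theorem contDiff_cutoff_mul {f : R4 → ℝ} (hf : ∀ x ≠ 0, ContDiffAt ℝ ∞ f x) :
    ContDiff ℝ ∞ (fun x => cutoff (‖x‖ ^ 2) * f x) := by
  refine contDiff_iff_contDiffAt.2 fun x => ?_
  rcases eq_or_ne x 0 with rfl | hx
  · refine (contDiffAt_const (c := (0 : ℝ))).congr_of_eventuallyEq ?_
    filter_upwards [ball_mem_nhds (0 : R4) (show (0 : ℝ) < 1 / 2 by norm_num)] with y hy
    rw [mem_ball_zero_iff] at hy
    rw [cutoff_eq_zero, zero_mul]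
    rw [abs_sub_comm]
    exact le_abs.2 (.inl (by nlinarith [norm_nonneg y]))
  · exact (cutoff.contDiff.comp (contDiff_norm_sq ℝ)).contDiffAt.mul (hf x hx)

theorem hasCompactSupport_cutoff_mul (f : R4 → ℝ) :
    HasCompactSupport (fun x => cutoff (‖x‖ ^ 2) * f x) := by
  refine .intro (isCompact_closedBall (0 : R4) 2) fun x hx => ?_
  rw [mem_closedBall_zero_iff, not_le] at hx
  rw [cutoff_eq_zero (le_abs.2 (.inl (by nlinarith))), zero_mul]

theorem integral_cutoff_sq_mul_inv_norm_sq_pos :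
    0 < ∫ x : R4, cutoff (‖x‖ ^ 2) ^ 2 * (‖x‖ ^ 2)⁻¹ := by
  have hinv (x : R4) (hx : x ≠ 0) : ContDiffAt ℝ ∞ (fun x : R4 => (‖x‖ ^ 2)⁻¹) x :=
    (contDiff_norm_sq ℝ).contDiffAt.inv (pow_ne_zero 2 (norm_ne_zero_iff.2 hx))
  have hcont := (contDiff_cutoff_mul fun x _ =>
    (contDiff_cutoff_mul hinv).contDiffAt (x := x)).continuous
  simp only [← mul_assoc, ← sq] at hcont
  have hsupp := hasCompactSupport_cutoff_mul fun x => cutoff (‖x‖ ^ 2) * (‖x‖ ^ 2)⁻¹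
  simp only [← mul_assoc, ← sq] at hsupp
  refine hcont.integral_pos_of_hasCompactSupport_nonneg_nonzero hsupp (fun x => by positivity)
    (x := EuclideanSpace.single 0 1) ?_
  have hone : cutoff (1 : ℝ) = 1 := cutoff.one_of_mem_closedBall (by simp [cutoff])
  simp [hone]

theorem integral_sphere_eq_zero {w : R4 → ℝ}
    (hw : ∀ (r : ℝ) (p : S3), 0 < r → w (r • (p : R4)) = (r ^ 2)⁻¹ * w p)
    (h : ∫ x : R4, cutoff (‖x‖ ^ 2) ^ 2 * w x = 0) : ∫ p : S3, w p ∂sphereMeasure = 0 := by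
  have hpos := integral_cutoff_sq_mul_inv_norm_sq_pos
  rw [integral_polar (fun r => cutoff (r ^ 2) ^ 2) (fun x => (‖x‖ ^ 2)⁻¹)
    (fun r p _ => by simp [norm_smul])] at hpos
  rw [integral_polar (fun r => cutoff (r ^ 2) ^ 2) w hw] at h
  exact (mul_eq_zero.1 h).resolve_right (right_ne_zero_of_mul hpos.ne')

theorem laplacian_cutoff_mul {f : S3 → ℝ} (hf : Smooth f) {x : R4} (hx : x ≠ 0) :
    Δ (fun y => cutoff (‖y‖ ^ 2) * homExt f y) x =
      cutoff (‖x‖ ^ 2) * Δ (homExt f) x + homExt f x * Δ (fun y : R4 => cutoff (‖y‖ ^ 2)) x := by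
  have hgrad : gradient (fun y : R4 => cutoff (‖y‖ ^ 2)) x =
      deriv cutoff (‖x‖ ^ 2) • (2 : ℝ) • x := by
    rw [gradient_comp (F := cutoff) (u := fun y : R4 => ‖y‖ ^ 2)
      ((cutoff.contDiff (n := 1)).differentiable (by simp) _).hasDerivAt
      ((contDiff_norm_sq ℝ (n := 1)).differentiable (by simp) x), gradient_norm_sq]
  rw [laplacian_mul (f := fun y : R4 => cutoff (‖y‖ ^ 2))
    (cutoff.contDiff.comp (contDiff_norm_sq ℝ)).contDiffAt (contDiffAt_two_homExt hf hx),
    hgrad, inner_smul_left, inner_smul_left, inner_self_gradient_homExt hf hx]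
  ring

theorem integral_mul_sphereLaplacian_comm {f g : S3 → ℝ} (hf : Smooth f) (hg : Smooth g) :
    ∫ p, f p * sphereLaplacian g p ∂sphereMeasure =
      ∫ p, sphereLaplacian f p * g p ∂sphereMeasure := by
  let w (x : R4) : ℝ := homExt f x * Δ (homExt g) x - Δ (homExt f) x * homExt g x
  let F (x : R4) : ℝ := cutoff (‖x‖ ^ 2) * homExt f x
  let G (x : R4) : ℝ := cutoff (‖x‖ ^ 2) * homExt g x
  have hF : ContDiff ℝ ∞ F := contDiff_cutoff_mul fun x hx => contDiffAt_homExt hf hx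
  have hG : ContDiff ℝ ∞ G := contDiff_cutoff_mul fun x hx => contDiffAt_homExt hg hx
  have hw_smul (r : ℝ) (p : S3) (hr : 0 < r) : w (r • (p : R4)) = (r ^ 2)⁻¹ * w p := by
    simp only [w, homExt_smul _ hr, laplacian_homExt_smul hf hr (coe_ne_zero p),
      laplacian_homExt_smul hg hr (coe_ne_zero p)]
    ring
  have hwFG : ∀ᵐ x : R4, cutoff (‖x‖ ^ 2) ^ 2 * w x = F x * Δ G x - Δ F x * G x := by
    filter_upwards [Measure.ae_ne volume (0 : R4)] with x hx
    simp only [w, F, G, laplacian_cutoff_mul hf hx, laplacian_cutoff_mul hg hx]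
    ring
  have hw_zero : ∫ p : S3, w p ∂sphereMeasure = 0 := by
    refine integral_sphere_eq_zero hw_smul ?_
    rw [integral_congr_ae hwFG]
    exact integral_mul_laplacian_sub_eq_zero hF (hasCompactSupport_cutoff_mul _) hG
      (hasCompactSupport_cutoff_mul _)
  simp only [w, homExt_coe] at hw_zero
  exact sub_eq_zero.1 ((integral_sub
    (integrable_sphereMeasure (hf.continuous.mul hg.sphereLaplacian.continuous))
    (integrable_sphereMeasure (hf.sphereLaplacian.continuous.mul hg.continuous))).symm.trans
    hw_zero)

theorem integral_sphereLaplacian {f : S3 → ℝ} (hf : Smooth f) :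
    ∫ p, sphereLaplacian f p ∂sphereMeasure = 0 := by
  simpa [sphereLaplacian_const] using
    (integral_mul_sphereLaplacian_comm hf (contMDiff_const (c := (1 : ℝ)))).symm

theorem integral_mul_paneitz_comm {f g : S3 → ℝ} (hf : Smooth f) (hg : Smooth g) :
    ∫ p, f p * paneitz g p ∂sphereMeasure = ∫ p, paneitz f p * g p ∂sphereMeasure := by
  have hΔΔ : ∫ p, f p * sphereLaplacian (sphereLaplacian g) p ∂sphereMeasure =
      ∫ p, sphereLaplacian (sphereLaplacian f) p * g p ∂sphereMeasure := by
    rw [integral_mul_sphereLaplacian_comm hf hg.sphereLaplacian,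
      integral_mul_sphereLaplacian_comm hf.sphereLaplacian hg]
  have hexpand (u v : S3 → ℝ) (hu : Smooth u) (hv : Smooth v) :
      ∫ p, u p * paneitz v p ∂sphereMeasure =
        ∫ p, u p * sphereLaplacian (sphereLaplacian v) p ∂sphereMeasure +
          1 / 2 * ∫ p, u p * sphereLaplacian v p ∂sphereMeasure -
          15 / 16 * ∫ p, u p * v p ∂sphereMeasure := by
    have hc := hu.continuous
    have hc0 := hv.continuous
    have hc1 := hv.sphereLaplacian.continuous
    have hc2 := hv.sphereLaplacian.sphereLaplacian.continuous
    rw [← integral_const_mul, ← integral_const_mul,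
      ← integral_add (integrable_sphereMeasure (by fun_prop))
        (integrable_sphereMeasure (by fun_prop)),
      ← integral_sub (integrable_sphereMeasure (by fun_prop))
        (integrable_sphereMeasure (by fun_prop))]
    congr! 2 with p
    simp only [paneitz]
    ring
  rw [hexpand f g hf hg, hΔΔ, integral_mul_sphereLaplacian_comm hf hg]
  simp only [mul_comm _ (g _)]
  exact (hexpand g f hg hf).symm

end SelfAdjoint

section Zonal

theorem inner_mem_Icc (a p : S3) : ⟪(a : R4), (p : R4)⟫_ℝ ∈ Icc (-1 : ℝ) 1 := by
  have h := abs_real_inner_le_norm (a : R4) (p : R4)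
  rw [norm_coe, norm_coe, one_mul] at h
  exact abs_le.1 h

theorem homExt_zonal (F : ℝ → ℝ) (a : R4) {x : R4} (hx : x ≠ 0) :
    homExt (fun y : S3 => F ⟪a, (y : R4)⟫_ℝ) x = F (⟪a, x⟫_ℝ * (‖x‖ ^ 2) ^ (-(1 / 2) : ℝ)) := by
  rw [homExt_of_ne hx, ← Real.rpow_natCast, ← Real.rpow_mul (norm_nonneg x)]
  norm_num [toS3, inner_smul_right, Real.rpow_neg_one, mul_comm]

theorem hasDerivAt_rpow_const {s : ℝ} (hs : 0 < s) (α : ℝ) :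
    HasDerivAt (fun s : ℝ => s ^ α) (α * s ^ (α - 1)) s :=
  Real.hasDerivAt_rpow_const (Or.inl hs.ne')

theorem contDiffAt_inv_norm {x : R4} (hx : x ≠ 0) :
    ContDiffAt ℝ ∞ (fun x : R4 => (‖x‖ ^ 2) ^ (-(1 / 2) : ℝ)) x :=
  (contDiff_norm_sq ℝ).contDiffAt.rpow_const_of_ne (by positivity)

theorem gradient_inv_norm (p : S3) :
    gradient (fun x : R4 => (‖x‖ ^ 2) ^ (-(1 / 2) : ℝ)) (p : R4) = -(p : R4) := by
  have hderiv := hasDerivAt_rpow_const (s := ‖(p : R4)‖ ^ 2) (by simp) (-(1 / 2))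
  rw [gradient_comp (u := fun x : R4 => ‖x‖ ^ 2) hderiv
      ((contDiff_norm_sq ℝ (n := 1)).differentiable (by simp) _),
    gradient_norm_sq, norm_coe, smul_smul]
  norm_num

theorem laplacian_inv_norm (p : S3) :
    Δ (fun x : R4 => (‖x‖ ^ 2) ^ (-(1 / 2) : ℝ)) (p : R4) = -1 := by
  have hpos : 0 < ‖(p : R4)‖ ^ 2 := by simp
  rw [laplacian_comp (F := fun s => s ^ (-(1 / 2) : ℝ)) (u := fun x : R4 => ‖x‖ ^ 2)
    ((lt_mem_nhds hpos).mono fun s hs => hasDerivAt_rpow_const hs _)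
    ((hasDerivAt_rpow_const hpos _).const_mul _) (contDiff_norm_sq ℝ).contDiffAt,
    gradient_norm_sq, laplacian_norm_sq, norm_smul, norm_coe, finrank_euclideanSpace_fin]
  norm_num

theorem sphereLaplacian_zonal {F F' : ℝ → ℝ} {F'' : ℝ} {a p : S3} {t : ℝ}
    (ht : ⟪(a : R4), (p : R4)⟫_ℝ = t) (hF : ∀ᶠ s in 𝓝 t, HasDerivAt F (F' s) s)
    (hF' : HasDerivAt F' F'' t) :
    sphereLaplacian (fun y : S3 => F ⟪(a : R4), (y : R4)⟫_ℝ) p =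
      (1 - t ^ 2) * F'' - 3 * t * F' t := by
  let u (x : R4) : ℝ := ⟪(a : R4), x⟫_ℝ * (‖x‖ ^ 2) ^ (-(1 / 2) : ℝ)
  have hlin : ContDiffAt ℝ 2 (fun x : R4 => ⟪(a : R4), x⟫_ℝ) p :=
    contDiffAt_const.inner ℝ contDiffAt_id
  have hinv : ContDiffAt ℝ 2 (fun x : R4 => (‖x‖ ^ 2) ^ (-(1 / 2) : ℝ)) p :=
    (contDiffAt_inv_norm (coe_ne_zero p)).of_le (WithTop.coe_le_coe.2 le_top)
  have hut : u p = t := by simp [u, ht]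
  have hgrad : gradient u p = (a : R4) - t • (p : R4) := by
    rw [gradient_mul (hlin.differentiableAt (by simp)) (hinv.differentiableAt (by simp)),
      gradient_inner, gradient_inv_norm, ht]
    simp [sub_eq_neg_add]
  have hgrad_sq : ‖gradient u p‖ ^ 2 = 1 - t ^ 2 := by
    rw [hgrad, norm_sub_sq_real, inner_smul_right, ht, norm_smul, norm_coe, norm_coe,
      Real.norm_eq_abs, mul_one, sq_abs]
    ring
  have hlap : Δ u p = -3 * t := by
    rw [laplacian_mul hlin hinv, laplacian_inner, laplacian_inv_norm, gradient_inner,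
      gradient_inv_norm, inner_neg_right, ht]
    ring
  rw [sphereLaplacian_eq_of_homExt (F := fun x => F (u x)) (fun x hx => homExt_zonal F a hx),
    laplacian_comp (u := u) (hut ▸ hF) (hut ▸ hF') (hlin.mul hinv), hut, hgrad_sq, hlap]
  ring

theorem Smooth.zonal {F : ℝ → ℝ} (a : S3) (hF : ∀ t ∈ Icc (-1 : ℝ) 1, ContDiffAt ℝ ∞ F t) :
    Smooth fun y => F ⟪(a : R4), (y : R4)⟫_ℝ :=
  .of_contDiffAt (F := fun x => F ⟪(a : R4), x⟫_ℝ) fun p =>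
    (hF _ (inner_mem_Icc a p)).comp (p : R4) (contDiffAt_const.inner ℝ contDiffAt_id)

end Zonal

section ShiftedPowers

theorem sphereLaplacian_add {f g : S3 → ℝ} (hf : Smooth f) (hg : Smooth g) (p : S3) :
    sphereLaplacian (f + g) p = sphereLaplacian f p + sphereLaplacian g p := by
  have hp := coe_ne_zero p
  rw [sphereLaplacian_eq_of_homExt (F := homExt f + homExt g)
    (fun x hx => by simp only [Pi.add_apply, homExt_of_ne hx])]
  exact (contDiffAt_two_homExt hf hp).laplacian_add (contDiffAt_two_homExt hg hp)

theorem sphereLaplacian_smul (r : ℝ) {f : S3 → ℝ} (hf : Smooth f) (p : S3) :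
    sphereLaplacian (r • f) p = r * sphereLaplacian f p := by
  rw [sphereLaplacian_eq_of_homExt (F := r • homExt f)
    (fun x hx => by simp only [Pi.smul_apply, homExt_of_ne hx])]
  exact InnerProductSpace.laplacian_smul r (contDiffAt_two_homExt hf (coe_ne_zero p))

theorem paneitz_smul (r : ℝ) {f : S3 → ℝ} (hf : Smooth f) (p : S3) :
    paneitz (r • f) p = r * paneitz f p := by
  have h : sphereLaplacian (r • f) = r • sphereLaplacian f :=
    funext (sphereLaplacian_smul r hf)
  rw [paneitz, h, sphereLaplacian_smul r hf.sphereLaplacian, paneitz]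
  simp only [Pi.smul_apply, smul_eq_mul]
  ring

/-- The zonal function `y ↦ (c - a · y) ^ α`, with its singularity outside the sphere if
`1 < c`. -/
def shiftPow (c α : ℝ) (a y : S3) : ℝ := (c - ⟪(a : R4), (y : R4)⟫_ℝ) ^ α

variable {c : ℝ} (hc : 1 < c)
include hc

theorem sub_inner_pos (a y : S3) : 0 < c - ⟪(a : R4), (y : R4)⟫_ℝ :=
  sub_pos.2 ((inner_mem_Icc a y).2.trans_lt hc)

theorem smooth_shiftPow (α : ℝ) (a : S3) : Smooth (shiftPow c α a) :=
  .zonal (F := fun t => (c - t) ^ α) a fun _ ht =>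
    (contDiffAt_const.sub contDiffAt_id).rpow_const_of_ne (sub_pos.2 (ht.2.trans_lt hc)).ne'

theorem sphereLaplacian_shiftPow (α : ℝ) (a p : S3) :
    sphereLaplacian (shiftPow c α a) p = α * (α - 1) * (1 - c ^ 2) * shiftPow c (α - 2) a p +
      α * (2 * α + 1) * c * shiftPow c (α - 1) a p - α * (α + 2) * shiftPow c α a p := by
  have hderiv (β : ℝ) {t : ℝ} (ht : t < c) :
      HasDerivAt (fun t : ℝ => (c - t) ^ β) (-(β * (c - t) ^ (β - 1))) t := by
    simpa using ((hasDerivAt_id t).const_sub c).rpow_const (p := β) (.inl (sub_pos.2 ht).ne')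
  have hs := sub_inner_pos hc a p
  have hlap := sphereLaplacian_zonal rfl
    ((gt_mem_nhds (sub_pos.1 hs)).mono fun t ht => hderiv α ht)
    (((hderiv (α - 1) (sub_pos.1 hs)).const_mul α).neg)
  refine hlap.trans ?_
  simp only [shiftPow]
  set s := c - ⟪(a : R4), (p : R4)⟫_ℝ with hst
  have hpow_one : s ^ (α - 1) = s ^ (α - 2) * s := by
    rw [← Real.rpow_add_one hs.ne']
    ring_nf
  have hpow_two : s ^ α = s ^ (α - 2) * s ^ 2 := by
    rw [← Real.rpow_natCast, ← Real.rpow_add hs]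
    norm_num
  rw [show ⟪(a : R4), (p : R4)⟫_ℝ = c - s by rw [hst]; ring, hpow_two, hpow_one,
    show α - 1 - 1 = α - 2 by ring]
  ring

theorem paneitz_shiftPow_half (a p : S3) :
    paneitz (shiftPow c (1 / 2) a) p =
      -(15 / 16 * (c ^ 2 - 1) ^ 2 * shiftPow c (-(7 / 2)) a p) := by
  have hsmooth (r α : ℝ) : Smooth (r • shiftPow c α a) :=
    contMDiff_const.mul (smooth_shiftPow hc α a)
  have hlap : sphereLaplacian (shiftPow c (1 / 2) a) = ((c ^ 2 - 1) / 4) • shiftPow c (-(3 / 2)) a +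
      c • shiftPow c (-(1 / 2)) a + (-(5 / 4) : ℝ) • shiftPow c (1 / 2) a := by
    funext q
    simp only [sphereLaplacian_shiftPow hc, Pi.add_apply, Pi.smul_apply, smul_eq_mul]
    ring_nf
  rw [paneitz, hlap, sphereLaplacian_add ((hsmooth _ _).add (hsmooth _ _)) (hsmooth _ _),
    sphereLaplacian_add (hsmooth _ _) (hsmooth _ _)]
  simp only [sphereLaplacian_smul _ (smooth_shiftPow hc _ a), sphereLaplacian_shiftPow hc,
    Pi.add_apply, Pi.smul_apply, smul_eq_mul]
  ring_nf

end ShiftedPowers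

section ZonalIntegral

theorem integral_eq_of_forall_integral_pow_eq {μ ν : Measure ℝ} [IsFiniteMeasure μ]
    [IsFiniteMeasure ν] {a b : ℝ} (hμ : ∀ᵐ t ∂μ, t ∈ Icc a b) (hν : ∀ᵐ t ∂ν, t ∈ Icc a b)
    (hpow : ∀ n : ℕ, ∫ t, t ^ n ∂μ = ∫ t, t ^ n ∂ν) {f : ℝ → ℝ} (hf : Continuous f) :
    ∫ t, f t ∂μ = ∫ t, f t ∂ν := by
  have hint {κ : Measure ℝ} [IsFiniteMeasure κ] (hκ : ∀ᵐ t ∂κ, t ∈ Icc a b) {g : ℝ → ℝ}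
      (hg : Continuous g) : Integrable g κ := by
    rw [← Measure.restrict_eq_self_of_ae_mem hκ]
    exact hg.continuousOn.integrableOn_compact isCompact_Icc
  have hpoly (q : Polynomial ℝ) : ∫ t, q.eval t ∂μ = ∫ t, q.eval t ∂ν := by
    simp only [Polynomial.eval_eq_sum_range]
    rw [integral_finsetSum _ fun n _ => hint hμ (by fun_prop),
      integral_finsetSum _ fun n _ => hint hν (by fun_prop)]
    simp only [integral_const_mul, hpow]
  have happrox {δ : ℝ} (hδ : 0 < δ) :
      |∫ t, f t ∂μ - ∫ t, f t ∂ν| ≤ δ * (μ.real univ + ν.real univ) := by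
    obtain ⟨q, hq⟩ := exists_polynomial_near_of_continuousOn a b f hf.continuousOn δ hδ
    have hclose {κ : Measure ℝ} [IsFiniteMeasure κ] (hκ : ∀ᵐ t ∂κ, t ∈ Icc a b) :
        |∫ t, q.eval t ∂κ - ∫ t, f t ∂κ| ≤ δ * κ.real univ := by
      rw [← integral_sub (hint hκ (by fun_prop)) (hint hκ hf)]
      exact norm_integral_le_of_norm_le_const
        (hκ.mono fun t ht => (Real.norm_eq_abs _).trans_le (hq t ht).le)
    have h := (abs_sub _ _).trans (add_le_add (hclose hν) (hclose hμ))
    rw [hpoly, sub_sub_sub_cancel_left] at h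
    linarith
  refine sub_eq_zero.1 (abs_eq_zero.1 (le_antisymm ?_ (abs_nonneg _)))
  refine le_of_forall_pos_le_add fun η hη => ?_
  set V := μ.real univ + ν.real univ
  have : 0 ≤ V := by positivity
  have hsmall : V / (V + 1) ≤ 1 := (div_le_one (by positivity)).2 (by linarith)
  calc _ ≤ η / (V + 1) * V := happrox (by positivity)
    _ = η * (V / (V + 1)) := by ring
    _ ≤ 0 + η := by nlinarith

theorem sphereMeasure_real_univ : sphereMeasure.real univ = 2 * Real.pi ^ 2 := by
  have hGamma : Real.Gamma ((4 : ℝ) / 2 + 1) = 2 := by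
    norm_num [show (4 : ℝ) / 2 + 1 = (2 : ℕ) + 1 by norm_num, Real.Gamma_nat_eq_factorial]
  have hsqrt : √Real.pi ^ 4 = Real.pi ^ 2 := by
    rw [show 4 = 2 * 2 from rfl, pow_mul, Real.sq_sqrt Real.pi_pos.le]
  rw [Measure.toSphere_real_apply_univ, Measure.real, EuclideanSpace.volume_ball]
  simp only [finrank_euclideanSpace, Fintype.card_fin, Nat.cast_ofNat, ENNReal.ofReal_one, one_pow,
    one_mul, hGamma, hsqrt]
  rw [ENNReal.toReal_ofReal (by positivity)]
  ring

theorem integral_zonal_laplacian_eq_zero (a : S3) {F F' F'' : ℝ → ℝ} (hF : ContDiff ℝ ∞ F)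
    (hF' : ∀ t, HasDerivAt F (F' t) t) (hF'' : ∀ t, HasDerivAt F' (F'' t) t) :
    ∫ y : S3, ((1 - ⟪(a : R4), (y : R4)⟫_ℝ ^ 2) * F'' ⟪(a : R4), (y : R4)⟫_ℝ -
      3 * ⟪(a : R4), (y : R4)⟫_ℝ * F' ⟪(a : R4), (y : R4)⟫_ℝ) ∂sphereMeasure = 0 := by
  rw [← integral_sphereLaplacian (.zonal a fun t _ => hF.contDiffAt)]
  exact integral_congr_ae (.of_forall fun y =>
    (sphereLaplacian_zonal rfl (.of_forall hF') (hF'' _)).symm)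

/-- The integrand is the derivative of `(1 - t ^ 2) ^ (3 / 2) * F' t`. -/
theorem integral_interval_laplacian_eq_zero {F' F'' : ℝ → ℝ} (hF' : Continuous F')
    (hF'' : Continuous F'') (hderiv : ∀ t, HasDerivAt F' (F'' t) t) :
    ∫ t in (-1 : ℝ)..1, ((1 - t ^ 2) * F'' t - 3 * t * F' t) * √(1 - t ^ 2) = 0 := by
  have h := intervalIntegral.integral_eq_sub_of_hasDerivAt_of_le (a := -1) (b := 1) (by norm_num)
    (f := fun t => (1 - t ^ 2) * √(1 - t ^ 2) * F' t)
    (f' := fun t => ((1 - t ^ 2) * F'' t - 3 * t * F' t) * √(1 - t ^ 2))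
    (by fun_prop) ?_ (Continuous.intervalIntegrable (by fun_prop) _ _)
  · simpa using h
  intro t ht
  have hpos : 0 < 1 - t ^ 2 := by nlinarith [ht.1, ht.2]
  have hsq : HasDerivAt (fun t : ℝ => 1 - t ^ 2) (-(2 * t)) t := by
    simpa using ((hasDerivAt_id t).pow 2).const_sub 1
  have hs : √(1 - t ^ 2) ≠ 0 := (Real.sqrt_pos.2 hpos).ne'
  refine ((hsq.mul (hsq.sqrt hpos.ne')).mul (hderiv t)).congr_deriv ?_
  simp only [Pi.mul_apply]
  field_simp
  rw [Real.sq_sqrt hpos.le]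
  ring

theorem one_sub_sq_mul_pow_sub (n : ℕ) (t : ℝ) :
    (1 - t ^ 2) * (n * t ^ (n - 1)) - 3 * t * t ^ n = n * t ^ (n - 1) - (n + 3) * t ^ (n + 1) := by
  cases n with
  | zero => simp
  | succ n =>
    rw [Nat.add_sub_cancel]
    ring

theorem integral_inner_pow_succ (a : S3) (n : ℕ) :
    (n + 3) * ∫ y : S3, ⟪(a : R4), (y : R4)⟫_ℝ ^ (n + 1) ∂sphereMeasure =
      n * ∫ y : S3, ⟪(a : R4), (y : R4)⟫_ℝ ^ (n - 1) ∂sphereMeasure := by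
  have h := integral_zonal_laplacian_eq_zero a (F := fun t => (n + 1 : ℝ)⁻¹ * t ^ (n + 1))
    (F' := fun t => t ^ n) (F'' := fun t => n * t ^ (n - 1))
    (contDiff_const.mul (contDiff_id.pow _))
    (fun t => by
      simpa [inv_mul_cancel_left₀ (show (n + 1 : ℝ) ≠ 0 by positivity)] using
        (hasDerivAt_pow (n + 1) t).const_mul (n + 1 : ℝ)⁻¹)
    (hasDerivAt_pow n)
  simp only [one_sub_sq_mul_pow_sub] at h
  rw [integral_sub (integrable_sphereMeasure (by fun_prop))
    (integrable_sphereMeasure (by fun_prop)), integral_const_mul, integral_const_mul] at h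
  exact (sub_eq_zero.1 h).symm

theorem integral_pow_succ_mul_sqrt (n : ℕ) :
    (n + 3) * ∫ t in (-1 : ℝ)..1, t ^ (n + 1) * √(1 - t ^ 2) =
      n * ∫ t in (-1 : ℝ)..1, t ^ (n - 1) * √(1 - t ^ 2) := by
  have h := integral_interval_laplacian_eq_zero (F' := fun t => t ^ n)
    (F'' := fun t => n * t ^ (n - 1)) (by fun_prop) (by fun_prop) (hasDerivAt_pow n)
  simp only [one_sub_sq_mul_pow_sub] at h
  simp only [sub_mul, mul_assoc] at h
  rw [intervalIntegral.integral_sub (Continuous.intervalIntegrable (by fun_prop) _ _)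
      (Continuous.intervalIntegrable (by fun_prop) _ _),
    intervalIntegral.integral_const_mul, intervalIntegral.integral_const_mul] at h
  exact (sub_eq_zero.1 h).symm

theorem integral_inner_pow (a : S3) (n : ℕ) :
    ∫ y : S3, ⟪(a : R4), (y : R4)⟫_ℝ ^ n ∂sphereMeasure =
      4 * Real.pi * ∫ t in (-1 : ℝ)..1, t ^ n * √(1 - t ^ 2) := by
  induction n using Nat.twoStepInduction with
  | zero =>
    simp only [pow_zero, one_mul, integral_const, smul_eq_mul, mul_one, integral_sqrt_one_sub_sq,
      sphereMeasure_real_univ]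
    ring
  | one =>
    have hsphere := integral_inner_pow_succ a 0
    have hinterval := integral_pow_succ_mul_sqrt 0
    norm_num at hsphere hinterval
    simp [hsphere, hinterval]
  | more n ih _ =>
    have hsphere := integral_inner_pow_succ a (n + 1)
    have hinterval := integral_pow_succ_mul_sqrt (n + 1)
    rw [Nat.add_sub_cancel, ih] at hsphere
    rw [Nat.add_sub_cancel] at hinterval
    refine mul_left_cancel₀ (show ((n + 1 : ℕ) + 3 : ℝ) ≠ 0 by positivity) ?_
    linear_combination hsphere - 4 * Real.pi * hinterval

theorem integral_zonal (a : S3) {f : ℝ → ℝ} (hf : Continuous f) :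
    ∫ y : S3, f ⟪(a : R4), (y : R4)⟫_ℝ ∂sphereMeasure =
      4 * Real.pi * ∫ t in (-1 : ℝ)..1, f t * √(1 - t ^ 2) := by
  have hheight : Measurable fun y : S3 => ⟪(a : R4), (y : R4)⟫_ℝ :=
    Continuous.measurable (by fun_prop)
  let μ : Measure ℝ := sphereMeasure.map fun y : S3 => ⟪(a : R4), (y : R4)⟫_ℝ
  let w (t : ℝ) : NNReal := Real.toNNReal (4 * Real.pi * √(1 - t ^ 2))
  let ν : Measure ℝ := (volume.restrict (Ioc (-1) 1)).withDensity fun t => w t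
  have hw : Continuous w := by fun_prop
  have hμ {g : ℝ → ℝ} (hg : Continuous g) :
      ∫ t, g t ∂μ = ∫ y : S3, g ⟪(a : R4), (y : R4)⟫_ℝ ∂sphereMeasure :=
    integral_map hheight.aemeasurable hg.aestronglyMeasurable
  have hν (g : ℝ → ℝ) : ∫ t, g t ∂ν = 4 * Real.pi * ∫ t in (-1 : ℝ)..1, g t * √(1 - t ^ 2) := by
    rw [integral_withDensity_eq_integral_smul hw.measurable,
      intervalIntegral.integral_of_le (by norm_num), ← integral_const_mul]
    refine integral_congr_ae (.of_forall fun t => ?_)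
    simp only [w, NNReal.smul_def, smul_eq_mul]
    rw [Real.coe_toNNReal _ (by positivity)]
    ring
  have : IsFiniteMeasure μ := Measure.isFiniteMeasure_map _ _
  have : IsFiniteMeasure ν := isFiniteMeasure_withDensity_ofReal
    (Continuous.integrableOn_Ioc (by fun_prop)).2
  rw [← hμ hf, ← hν]
  refine integral_eq_of_forall_integral_pow_eq (a := -1) (b := 1)
    ((ae_map_iff hheight.aemeasurable measurableSet_Icc).2 (.of_forall (inner_mem_Icc a)))
    ((withDensity_absolutelyContinuous _ _).ae_le
      ((ae_restrict_mem measurableSet_Ioc).mono fun t ht => Ioc_subset_Icc_self ht))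
    (fun n => ?_) hf
  rw [hμ (by fun_prop), hν, integral_inner_pow]

theorem integral_sqrt_one_sub_mul_sqrt :
    ∫ t in (-1 : ℝ)..1, √(1 - t) * √(1 - t ^ 2) = 16 * √2 / 15 := by
  have hpow (t : ℝ) (ht : t ∈ uIcc (-1 : ℝ) 1) :
      √(1 - t) * √(1 - t ^ 2) = 2 * (t + 1) ^ (1 / 2 : ℝ) - (t + 1) ^ (3 / 2 : ℝ) := by
    rw [uIcc_of_le (by norm_num)] at ht
    have hsub : 0 ≤ 1 - t := sub_nonneg.2 ht.2
    have hadd : 0 ≤ t + 1 := by linarith [ht.1]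
    rw [show 1 - t ^ 2 = (1 - t) * (t + 1) by ring, Real.sqrt_mul hsub, ← mul_assoc,
      Real.mul_self_sqrt hsub, show (3 / 2 : ℝ) = 1 / 2 + 1 by norm_num,
      Real.rpow_add_one' hadd (by norm_num), Real.sqrt_eq_rpow]
    ring
  have hint (r : ℝ) (hr : 0 ≤ r) : IntervalIntegrable (fun u : ℝ => u ^ r) volume 0 2 :=
    (continuous_id.rpow_const fun _ => .inr hr).intervalIntegrable _ _
  rw [intervalIntegral.integral_congr hpow, intervalIntegral.integral_comp_add_right
      (fun u : ℝ => 2 * u ^ (1 / 2 : ℝ) - u ^ (3 / 2 : ℝ))]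
  norm_num only
  rw [intervalIntegral.integral_sub ((hint _ (by norm_num)).const_mul 2) (hint _ (by norm_num)),
    intervalIntegral.integral_const_mul, integral_rpow (.inl (by norm_num)),
    integral_rpow (.inl (by norm_num)), Real.rpow_add_one two_ne_zero,
    show (3 / 2 : ℝ) = 1 / 2 + 1 by norm_num, Real.rpow_add_one two_ne_zero,
    Real.rpow_add_one two_ne_zero, Real.sqrt_eq_rpow]
  norm_num
  ring

theorem integral_sqrt_one_sub_inner (a : S3) :
    ∫ y : S3, √(1 - ⟪(a : R4), (y : R4)⟫_ℝ) ∂sphereMeasure = 64 * √2 * Real.pi / 15 := by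
  rw [integral_zonal a (f := fun t => √(1 - t)) (by fun_prop), integral_sqrt_one_sub_mul_sqrt]
  ring

end ZonalIntegral

section ZonalKernel

variable {k g : ℝ → ℝ} {h : S3 → ℝ} {A C ε t : ℝ}

/-- The north pole as a point of the sphere. -/
def north : S3 := ⟨northPole, by
  rw [mem_sphere_zero_iff_norm]
  simp [northPole, EuclideanSpace.norm_eq, Fin.sum_univ_four]⟩

/-- `pointAt t` as a point of the sphere. -/
def spherePoint (t : Icc (-1 : ℝ) 1) : S3 := ⟨pointAt t, by
  have ht : 0 ≤ 1 - (t : ℝ) ^ 2 := by nlinarith [t.2.1, t.2.2]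
  rw [mem_sphere_zero_iff_norm]
  simp [pointAt, EuclideanSpace.norm_eq, Fin.sum_univ_four, Real.sq_sqrt ht]⟩

theorem continuous_spherePoint : Continuous spherePoint := by
  refine Continuous.subtype_mk ?_ _
  unfold pointAt
  fun_prop

theorem inner_north_spherePoint (t : Icc (-1 : ℝ) 1) :
    ⟪(north : R4), (spherePoint t : R4)⟫_ℝ = t := by
  simp [north, spherePoint, northPole, pointAt, PiLp.inner_apply, Fin.sum_univ_four]

theorem exists_inner_north_eq (ht : t ∈ Icc (-1 : ℝ) 1) :
    ∃ z : S3, ⟪(north : R4), (z : R4)⟫_ℝ = t :=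
  ⟨spherePoint ⟨t, ht⟩, inner_north_spherePoint _⟩

theorem continuous_zonal (hk : ContinuousOn k (Icc (-1) 1)) {X : Type*} [TopologicalSpace X]
    {f₁ f₂ : X → S3} (h₁ : Continuous f₁) (h₂ : Continuous f₂) :
    Continuous fun x => k ⟪(f₁ x : R4), (f₂ x : R4)⟫_ℝ :=
  hk.comp_continuous (by fun_prop) fun _ => inner_mem_Icc _ _

theorem continuous_integral {X : Type*} [TopologicalSpace X] [FirstCountableTopology X]
    [LocallyCompactSpace X] {f : X → S3 → ℝ} (hf : Continuous (Function.uncurry f)) :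
    Continuous fun x => ∫ y, f x y ∂sphereMeasure := by
  simpa using continuous_parametric_integral_of_continuous (μ := sphereMeasure) hf isCompact_univ

/-- The integral operator on `S³` with kernel `k (x · y)`. -/
def zonalPotential (k : ℝ → ℝ) (h : S3 → ℝ) (x : S3) : ℝ :=
  ∫ y : S3, k ⟪(x : R4), (y : R4)⟫_ℝ * h y ∂sphereMeasure

theorem conv_inner_eq_zonalPotential (k g : ℝ → ℝ) (x z : S3) :
    conv k g ⟪(x : R4), (z : R4)⟫_ℝ = zonalPotential k (fun y => g ⟪(y : R4), (z : R4)⟫_ℝ) x :=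
  conv_inner k g x z

theorem continuous_zonal_mul (hk : ContinuousOn k (Icc (-1) 1)) (hh : Continuous h) (x : S3) :
    Continuous fun y : S3 => k ⟪(x : R4), (y : R4)⟫_ℝ * h y :=
  (continuous_zonal hk continuous_const continuous_id).mul hh

theorem continuous_zonalPotential (hk : ContinuousOn k (Icc (-1) 1)) (hh : Continuous h) :
    Continuous (zonalPotential k h) :=
  continuous_integral
    ((continuous_zonal hk continuous_fst continuous_snd).mul (hh.comp continuous_snd))

theorem zonalPotential_add (hk : ContinuousOn k (Icc (-1) 1)) {h₁ h₂ : S3 → ℝ}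
    (hh₁ : Continuous h₁) (hh₂ : Continuous h₂) (x : S3) :
    zonalPotential k (h₁ + h₂) x = zonalPotential k h₁ x + zonalPotential k h₂ x := by
  simp only [zonalPotential, Pi.add_apply, mul_add]
  exact integral_add (integrable_sphereMeasure (continuous_zonal_mul hk hh₁ x))
    (integrable_sphereMeasure (continuous_zonal_mul hk hh₂ x))

theorem zonalPotential_smul (k : ℝ → ℝ) (r : ℝ) (h : S3 → ℝ) (x : S3) :
    zonalPotential k (r • h) x = r * zonalPotential k h x := by
  simp only [zonalPotential, Pi.smul_apply, smul_eq_mul, mul_left_comm _ r, integral_const_mul]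

theorem zonalPotential_sub (hk : ContinuousOn k (Icc (-1) 1)) {h₁ h₂ : S3 → ℝ}
    (hh₁ : Continuous h₁) (hh₂ : Continuous h₂) (x : S3) :
    zonalPotential k (h₁ - h₂) x = zonalPotential k h₁ x - zonalPotential k h₂ x := by
  simp only [zonalPotential, Pi.sub_apply, mul_sub]
  exact integral_sub (integrable_sphereMeasure (continuous_zonal_mul hk hh₁ x))
    (integrable_sphereMeasure (continuous_zonal_mul hk hh₂ x))

theorem zonalPotential_conv (hk : ContinuousOn k (Icc (-1) 1)) (hg : ContinuousOn g (Icc (-1) 1))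
    (hh : Continuous h) (x : S3) :
    zonalPotential (conv k g) h x = zonalPotential k (zonalPotential g h) x := by
  simp only [zonalPotential, conv_inner, ← integral_mul_const, ← integral_const_mul]
  rw [integral_integral_swap]
  · simp only [mul_assoc]
  · refine Continuous.integrable_of_hasCompactSupport ?_ (HasCompactSupport.of_compactSpace _)
    exact ((continuous_zonal hk continuous_const continuous_snd).mul
      (continuous_zonal hg continuous_snd continuous_fst)).mul (hh.comp continuous_fst)

theorem abs_zonalPotential_le (hk : ContinuousOn k (Icc (-1) 1)) {x : S3}
    (hA : ∫ y : S3, |k ⟪(x : R4), (y : R4)⟫_ℝ| ∂sphereMeasure ≤ A) {M : ℝ} (hM : ∀ y, |h y| ≤ M) :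
    |zonalPotential k h x| ≤ A * M := by
  have hkx := continuous_zonal (X := S3) hk (continuous_const (y := x)) continuous_id
  calc |zonalPotential k h x| ≤ ∫ y : S3, |k ⟪(x : R4), (y : R4)⟫_ℝ| * M ∂sphereMeasure := by
        refine norm_integral_le_of_norm_le (f := fun y : S3 => k ⟪(x : R4), (y : R4)⟫_ℝ * h y)
          (integrable_sphereMeasure (hkx.abs.mul continuous_const)) (.of_forall fun y => ?_)
        rw [norm_mul]
        exact mul_le_mul_of_nonneg_left (hM y) (abs_nonneg _)
    _ = (∫ y : S3, |k ⟪(x : R4), (y : R4)⟫_ℝ| ∂sphereMeasure) * M := integral_mul_const _ _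
    _ ≤ A * M := mul_le_mul_of_nonneg_right hA ((abs_nonneg _).trans (hM x))

theorem eq_zero_of_eq_mul_zonalPotential (hk : ContinuousOn k (Icc (-1) 1))
    (hA : ∀ x : S3, ∫ y : S3, |k ⟪(x : R4), (y : R4)⟫_ℝ| ∂sphereMeasure ≤ A) (hε : |ε| * A < 1)
    (hh : Continuous h) (heq : ∀ x, h x = ε * zonalPotential k h x) : h = 0 := by
  funext x
  obtain ⟨x₀, -, hx₀⟩ := isCompact_univ.exists_isMaxOn ⟨x, mem_univ x⟩ hh.abs.continuousOn
  have hmax : ∀ y, |h y| ≤ |h x₀| := fun y => hx₀ (mem_univ y)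
  have hcontract : |h x₀| ≤ |ε| * A * |h x₀| := by
    conv_lhs => rw [heq x₀, abs_mul]
    rw [mul_assoc]
    exact mul_le_mul_of_nonneg_left (abs_zonalPotential_le hk (hA x₀) hmax) (abs_nonneg ε)
  have hzero : |h x₀| ≤ 0 := by nlinarith [abs_nonneg (h x₀)]
  exact abs_nonpos_iff.1 ((hmax x).trans hzero)

theorem continuousOn_conv (hk : ContinuousOn k (Icc (-1) 1)) (hg : ContinuousOn g (Icc (-1) 1)) :
    ContinuousOn (conv k g) (Icc (-1) 1) :=
  continuousOn_iff_continuous_domRestrict.2 <| continuous_integral <|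
    (continuous_zonal hk (continuous_const (y := north)) continuous_snd).mul
      (continuous_zonal hg continuous_snd (continuous_spherePoint.comp continuous_fst))

theorem continuousOn_convPow (hk : ContinuousOn k (Icc (-1) 1)) (j : ℕ) :
    ContinuousOn (convPow k j) (Icc (-1) 1) := by
  induction j with
  | zero => exact hk
  | succ j ih => exact continuousOn_conv hk ih

theorem abs_convPow_le (hk : ContinuousOn k (Icc (-1) 1))
    (hA : ∀ x : S3, ∫ y : S3, |k ⟪(x : R4), (y : R4)⟫_ℝ| ∂sphereMeasure ≤ A)
    (hC : ∀ t ∈ Icc (-1) 1, |k t| ≤ C) (j : ℕ) (ht : t ∈ Icc (-1) 1) :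
    |convPow k j t| ≤ A ^ j * C := by
  induction j generalizing t with
  | zero => simpa [convPow] using hC t ht
  | succ j ih =>
    obtain ⟨z, rfl⟩ := exists_inner_north_eq ht
    rw [convPow, conv_inner_eq_zonalPotential, pow_succ', mul_assoc]
    exact abs_zonalPotential_le hk (hA north) fun y => ih (inner_mem_Icc y z)

theorem norm_pow_mul_convPow_le (hk : ContinuousOn k (Icc (-1) 1))
    (hA : ∀ x : S3, ∫ y : S3, |k ⟪(x : R4), (y : R4)⟫_ℝ| ∂sphereMeasure ≤ A)
    (hC : ∀ t ∈ Icc (-1) 1, |k t| ≤ C) (ε : ℝ) (j : ℕ) (ht : t ∈ Icc (-1) 1) :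
    ‖ε ^ j * convPow k j t‖ ≤ (|ε| * A) ^ j * C := by
  rw [norm_mul, norm_pow, Real.norm_eq_abs, Real.norm_eq_abs, mul_pow, mul_assoc]
  exact mul_le_mul_of_nonneg_left (abs_convPow_le hk hA hC j ht) (by positivity)

end ZonalKernel

section NeumannSeries

/-- The Neumann series `∑ εʲ k^{*(j+1)}`, the profile of the kernel of `(K⁻¹ - ε)⁻¹`, where `K` is
the integral operator `zonalPotential k`. -/
def neumannSeries (k : ℝ → ℝ) (ε t : ℝ) : ℝ := ∑' j : ℕ, ε ^ j * convPow k j t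

variable {k : ℝ → ℝ} {A C ε t : ℝ} (hk : ContinuousOn k (Icc (-1) 1))
  (hA : ∀ x : S3, ∫ y : S3, |k ⟪(x : R4), (y : R4)⟫_ℝ| ∂sphereMeasure ≤ A)
  (hC : ∀ t ∈ Icc (-1) 1, |k t| ≤ C) (hε : |ε| * A < 1)

include hA hε

theorem hasSum_geometric_bound :
    HasSum (fun j : ℕ => (|ε| * A) ^ j * C) ((1 - |ε| * A)⁻¹ * C) :=
  (hasSum_geometric_of_lt_one (mul_nonneg (abs_nonneg ε)
    ((integral_nonneg fun _ => abs_nonneg _).trans (hA north))) hε).mul_right C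

include hk hC

theorem hasSum_neumannSeries (ht : t ∈ Icc (-1) 1) :
    HasSum (fun j : ℕ => ε ^ j * convPow k j t) (neumannSeries k ε t) :=
  (Summable.of_norm_bounded (hasSum_geometric_bound hA hε).summable
    fun j => norm_pow_mul_convPow_le hk hA hC ε j ht).hasSum

theorem abs_neumannSeries_le (ht : t ∈ Icc (-1) 1) :
    |neumannSeries k ε t| ≤ (1 - |ε| * A)⁻¹ * C :=
  tsum_of_norm_bounded (hasSum_geometric_bound hA hε)
    fun j => norm_pow_mul_convPow_le hk hA hC ε j ht

theorem continuousOn_neumannSeries : ContinuousOn (neumannSeries k ε) (Icc (-1) 1) :=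
  continuousOn_tsum (fun j => continuousOn_const.mul (continuousOn_convPow hk j))
    (hasSum_geometric_bound hA hε).summable
    fun j _ ht => norm_pow_mul_convPow_le hk hA hC ε j ht

theorem hasSum_conv_neumannSeries (ht : t ∈ Icc (-1) 1) :
    HasSum (fun j : ℕ => ε ^ j * convPow k (j + 1) t) (conv k (neumannSeries k ε) t) := by
  obtain ⟨z, rfl⟩ := exists_inner_north_eq ht
  have hterm : ∀ j, ε ^ j * convPow k (j + 1) ⟪(north : R4), (z : R4)⟫_ℝ =
      ∫ y : S3, k ⟪(north : R4), (y : R4)⟫_ℝ * (ε ^ j * convPow k j ⟪(y : R4), (z : R4)⟫_ℝ)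
        ∂sphereMeasure := fun j => by
    rw [convPow, conv_inner, ← integral_const_mul]
    simp only [mul_left_comm]
  simp only [hterm, conv_inner]
  have hcont : ∀ j, Continuous fun y : S3 => k ⟪(north : R4), (y : R4)⟫_ℝ *
      (ε ^ j * convPow k j ⟪(y : R4), (z : R4)⟫_ℝ) := fun j =>
    continuous_zonal_mul hk (continuous_const.mul
      (continuous_zonal (continuousOn_convPow hk j) continuous_id continuous_const)) north
  refine hasSum_integral_of_dominated_convergence (fun j _ => C * ((|ε| * A) ^ j * C))
    (fun j => (hcont j).aestronglyMeasurable) (fun j => .of_forall fun y => ?_)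
    (.of_forall fun _ => (hasSum_geometric_bound hA hε).summable.mul_left C)
    (integrable_const _)
    (.of_forall fun y => (hasSum_neumannSeries hk hA hC hε (inner_mem_Icc y z)).mul_left _)
  rw [norm_mul]
  exact mul_le_mul (hC _ (inner_mem_Icc _ _))
    (norm_pow_mul_convPow_le hk hA hC ε j (inner_mem_Icc y z)) (norm_nonneg _)
    ((abs_nonneg _).trans (hC _ (inner_mem_Icc north y)))

theorem neumannSeries_eq (ht : t ∈ Icc (-1) 1) :
    neumannSeries k ε t = k t + ε * conv k (neumannSeries k ε) t := by
  rw [neumannSeries, (hasSum_neumannSeries hk hA hC hε ht).summable.tsum_eq_zero_add,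
    ← ((hasSum_conv_neumannSeries hk hA hC hε ht).mul_left ε).tsum_eq]
  simp only [pow_zero, one_mul, convPow, pow_succ', mul_assoc]

theorem zonalPotential_neumannSeries {h : S3 → ℝ} (hh : Continuous h) (x : S3) :
    zonalPotential (neumannSeries k ε) h x =
      zonalPotential k h x + ε * zonalPotential k (zonalPotential (neumannSeries k ε) h) x := by
  have hN := continuousOn_neumannSeries hk hA hC hε
  rw [← zonalPotential_conv hk hN hh]
  simp only [zonalPotential, neumannSeries_eq hk hA hC hε (inner_mem_Icc _ _), add_mul, mul_assoc]
  rw [integral_add (integrable_sphereMeasure (continuous_zonal_mul hk hh x))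
    ((integrable_sphereMeasure
      (continuous_zonal_mul (continuousOn_conv hk hN) hh x)).const_mul ε),
    integral_const_mul]

end NeumannSeries

section FundamentalSolution

theorem continuous_kProfile : Continuous kProfile := by
  unfold kProfile
  fun_prop

theorem kProfile_nonneg (t : ℝ) : 0 ≤ kProfile t := by
  rw [kProfile]
  positivity

theorem integral_kProfile (a : S3) :
    ∫ y : S3, kProfile ⟪(a : R4), (y : R4)⟫_ℝ ∂sphereMeasure = 16 / 15 := by
  simp only [kProfile, integral_div, integral_sqrt_one_sub_inner]
  field_simp
  norm_num

theorem kProfile_shift (c : ℝ) (a : S3) :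
    (fun y : S3 => kProfile (⟪(a : R4), (y : R4)⟫_ℝ + (1 - c))) =
      (4 * √2 * Real.pi)⁻¹ • shiftPow c (1 / 2) a := by
  funext y
  rw [kProfile, Pi.smul_apply, shiftPow, ← Real.sqrt_eq_rpow, smul_eq_mul, div_eq_inv_mul]
  ring_nf

theorem tendsto_integral_kProfile_shift_mul (a : S3) {h : S3 → ℝ} (hh : Continuous h) :
    Tendsto (fun c => ∫ y : S3, kProfile (⟪(a : R4), (y : R4)⟫_ℝ + (1 - c)) * h y ∂sphereMeasure)
      (𝓝[>] 1) (𝓝 (zonalPotential kProfile h a)) := by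
  have hk := continuous_kProfile
  have hcont := continuous_parametric_integral_of_continuous (μ := sphereMeasure)
    (f := fun (c : ℝ) (y : S3) => kProfile (⟪(a : R4), (y : R4)⟫_ℝ + (1 - c)) * h y)
    (by unfold Function.uncurry; fun_prop) isCompact_univ
  simpa [zonalPotential] using (hcont.tendsto 1).mono_left nhdsWithin_le_nhds

/-- The function `-P (k (a · y + 1 - c))`, an approximate identity at `a` as `c ↓ 1`. -/
def peak (c : ℝ) (a : S3) : S3 → ℝ :=
  ((4 * √2 * Real.pi)⁻¹ * (15 / 16 * (c ^ 2 - 1) ^ 2)) • shiftPow c (-(7 / 2)) a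

theorem peak_nonneg {c : ℝ} (hc : 1 < c) (a y : S3) : 0 ≤ peak c a y :=
  mul_nonneg (by positivity) (Real.rpow_nonneg (sub_inner_pos hc a y).le _)

theorem continuous_peak {c : ℝ} (hc : 1 < c) (a : S3) : Continuous (peak c a) :=
  (smooth_shiftPow hc _ a).continuous.const_smul _

theorem smooth_kProfile_shift {c : ℝ} (hc : 1 < c) (a : S3) :
    Smooth fun y : S3 => kProfile (⟪(a : R4), (y : R4)⟫_ℝ + (1 - c)) := by
  rw [kProfile_shift]
  exact contMDiff_const.mul (smooth_shiftPow hc _ a)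

theorem paneitz_kProfile_shift {c : ℝ} (hc : 1 < c) (a y : S3) :
    paneitz (fun y : S3 => kProfile (⟪(a : R4), (y : R4)⟫_ℝ + (1 - c))) y = -peak c a y := by
  rw [kProfile_shift, paneitz_smul _ (smooth_shiftPow hc _ a), paneitz_shiftPow_half hc, peak,
    Pi.smul_apply, smul_eq_mul]
  ring

theorem integral_kProfile_shift_mul_paneitz {c : ℝ} (hc : 1 < c) (a : S3) {φ : S3 → ℝ}
    (hφ : Smooth φ) :
    ∫ y : S3, kProfile (⟪(a : R4), (y : R4)⟫_ℝ + (1 - c)) * paneitz φ y ∂sphereMeasure =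
      -∫ y, peak c a y * φ y ∂sphereMeasure := by
  rw [integral_mul_paneitz_comm (smooth_kProfile_shift hc a) hφ, ← integral_neg]
  simp only [paneitz_kProfile_shift hc, neg_mul]

theorem paneitz_one (p : S3) : paneitz (fun _ => 1) p = -(15 / 16) := by
  rw [paneitz, sphereLaplacian_const, sphereLaplacian_const]
  ring

theorem tendsto_integral_peak (a : S3) :
    Tendsto (fun c => ∫ y, peak c a y ∂sphereMeasure) (𝓝[>] 1) (𝓝 1) := by
  have hlim := (tendsto_integral_kProfile_shift_mul a (continuous_const (y := -(15 / 16)))).neg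
  rw [zonalPotential, integral_mul_const, integral_kProfile] at hlim
  norm_num only at hlim
  refine hlim.congr' (eventually_mem_nhdsWithin.mono fun c hc => ?_)
  have h := integral_kProfile_shift_mul_paneitz hc a (contMDiff_const (c := (1 : ℝ)))
  simp only [paneitz_one, mul_one] at h
  rw [h, neg_neg]

theorem inner_lt_one {a y : S3} (h : a ≠ y) : ⟪(a : R4), (y : R4)⟫_ℝ < 1 :=
  inner_lt_one_iff_real_of_norm_eq_one (norm_coe a) (norm_coe y) |>.2 (Subtype.coe_ne_coe.2 h)

theorem exists_inner_le_of_isOpen {a : S3} {u : Set S3} (hu : IsOpen u) (ha : a ∈ u) :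
    ∃ m < 1, ∀ y ∈ uᶜ, ⟪(a : R4), (y : R4)⟫_ℝ ≤ m := by
  rcases (uᶜ).eq_empty_or_nonempty with hempty | hne
  · exact ⟨0, one_pos, by simp [hempty]⟩
  obtain ⟨y, hy, hmax⟩ := hu.isClosed_compl.isCompact.exists_isMaxOn hne
    (f := fun y : S3 => ⟪(a : R4), (y : R4)⟫_ℝ) (by fun_prop)
  exact ⟨_, inner_lt_one (ne_of_mem_of_not_mem ha hy), fun z hz => hmax hz⟩

theorem tendstoUniformlyOn_peak {a : S3} {u : Set S3} (hu : IsOpen u) (ha : a ∈ u) :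
    TendstoUniformlyOn (fun c => peak c a) 0 (𝓝[>] 1) uᶜ := by
  obtain ⟨m, hm, hle⟩ := exists_inner_le_of_isOpen hu ha
  have hcont : Continuous fun c : ℝ =>
      (4 * √2 * Real.pi)⁻¹ * (15 / 16 * (c ^ 2 - 1) ^ 2) * (1 - m) ^ (-(7 / 2) : ℝ) := by
    fun_prop
  have hlim := (hcont.tendsto 1).mono_left (nhdsWithin_le_nhds (s := Ioi 1))
  norm_num only [sub_self, zero_mul, mul_zero] at hlim
  rw [Metric.tendstoUniformlyOn_iff]
  intro δ hδ
  filter_upwards [hlim.eventually (gt_mem_nhds hδ), self_mem_nhdsWithin] with c hsmall hc y hy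
  rw [Pi.zero_apply, dist_zero_left, Real.norm_of_nonneg (peak_nonneg hc a y)]
  refine lt_of_le_of_lt (mul_le_mul_of_nonneg_left ?_ (by positivity)) hsmall
  exact Real.rpow_le_rpow_of_nonpos (sub_pos.2 hm) (sub_le_sub (le_of_lt hc) (hle y hy))
    (by norm_num)

theorem tendsto_integral_peak_mul (a : S3) {h : S3 → ℝ} (hh : Continuous h) :
    Tendsto (fun c => ∫ y, peak c a y * h y ∂sphereMeasure) (𝓝[>] 1) (𝓝 (h a)) :=
  tendsto_integral_peak_smul_of_integrable_of_tendsto MeasurableSet.univ univ_mem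
    (measure_ne_top _ _) (eventually_mem_nhdsWithin.mono fun _ hc => peak_nonneg hc a)
    (fun _ hu ha => tendstoUniformlyOn_peak hu ha)
    (by simpa only [Measure.restrict_univ] using tendsto_integral_peak a)
    (eventually_mem_nhdsWithin.mono fun _ hc => (continuous_peak hc a).aestronglyMeasurable)
    (integrable_sphereMeasure hh) (hh.tendsto a)

theorem zonalPotential_kProfile_paneitz (a : S3) {φ : S3 → ℝ} (hφ : Smooth φ) :
    zonalPotential kProfile (paneitz φ) a = -φ a :=
  tendsto_nhds_unique_of_eventuallyEq
    (tendsto_integral_kProfile_shift_mul a hφ.paneitz.continuous)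
    (tendsto_integral_peak_mul a hφ.continuous).neg
    (eventually_mem_nhdsWithin.mono fun _ hc => integral_kProfile_shift_mul_paneitz hc a hφ)

end FundamentalSolution

section GreenFunction

variable {ε : ℝ}

theorem continuousOn_kProfile : ContinuousOn kProfile (Icc (-1) 1) :=
  continuous_kProfile.continuousOn

theorem integral_abs_kProfile_le (x : S3) :
    ∫ y : S3, |kProfile ⟪(x : R4), (y : R4)⟫_ℝ| ∂sphereMeasure ≤ 16 / 15 := by
  simp only [abs_of_nonneg (kProfile_nonneg _), integral_kProfile, le_refl]

theorem abs_kProfile_le {t : ℝ} (ht : t ∈ Icc (-1) 1) : |kProfile t| ≤ (4 * Real.pi)⁻¹ := by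
  have hsqrt : √(1 - t) ≤ √2 := Real.sqrt_le_sqrt (by linarith [ht.1])
  calc |kProfile t| = √(1 - t) / (4 * √2 * Real.pi) := abs_of_nonneg (kProfile_nonneg t)
    _ ≤ √2 / (4 * √2 * Real.pi) := by gcongr
    _ = (4 * Real.pi)⁻¹ := by field_simp

theorem eq_mul_zonalPotential_kProfile_of_orthogonal {h : S3 → ℝ} (hh : Continuous h)
    (horth : ∀ φ, Smooth φ → ∫ y, h y * (paneitz φ y + ε * φ y) ∂sphereMeasure = 0) (a : S3) :
    h a = ε * zonalPotential kProfile h a := by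
  refine tendsto_nhds_unique_of_eventuallyEq (tendsto_integral_peak_mul a hh)
    ((tendsto_integral_kProfile_shift_mul a hh).const_mul ε)
    (eventually_mem_nhdsWithin.mono fun c hc => ?_)
  have hk := continuous_kProfile
  have hpeak := continuous_peak hc a
  have hzero := horth _ (smooth_kProfile_shift hc a)
  simp only [paneitz_kProfile_shift hc] at hzero
  have hexpand : ∀ y, h y * (-peak c a y + ε * kProfile (⟪(a : R4), (y : R4)⟫_ℝ + (1 - c))) =
      ε * (kProfile (⟪(a : R4), (y : R4)⟫_ℝ + (1 - c)) * h y) - peak c a y * h y := fun y => by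
    ring
  simp only [hexpand] at hzero
  rw [integral_sub ((integrable_sphereMeasure (by fun_prop)).const_mul ε)
    (integrable_sphereMeasure (by fun_prop)), integral_const_mul] at hzero
  exact (sub_eq_zero.1 hzero).symm

theorem IsGreenFunction.unique (hε : |ε| < 15 / 16) {G G' : S3 → S3 → ℝ}
    (hG : IsGreenFunction (fun φ p => paneitz φ p + ε * φ p) G)
    (hG' : IsGreenFunction (fun φ p => paneitz φ p + ε * φ p) G') : G = G' := by
  funext x
  have hcont := hG.continuous.uncurry_left x
  have hcont' := hG'.continuous.uncurry_left x
  have horth : ∀ φ, Smooth φ →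
      ∫ y, (G x - G' x) y * (paneitz φ y + ε * φ y) ∂sphereMeasure = 0 := fun φ hφ => by
    have hψ : Continuous fun y => paneitz φ y + ε * φ y :=
      hφ.paneitz.continuous.add (hφ.continuous.const_smul ε)
    simp only [Pi.sub_apply, sub_mul]
    refine (integral_sub (integrable_sphereMeasure (hcont.mul hψ))
      (integrable_sphereMeasure (hcont'.mul hψ))).trans ?_
    exact sub_eq_zero.2 ((hG.integral_eq φ hφ x).trans (hG'.integral_eq φ hφ x).symm)
  exact sub_eq_zero.1 <| eq_zero_of_eq_mul_zonalPotential continuousOn_kProfile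
    integral_abs_kProfile_le (by linarith) (hcont.sub hcont')
    (eq_mul_zonalPotential_kProfile_of_orthogonal (hcont.sub hcont') horth)

section

variable (hε : |ε| < 15 / 16)
include hε

theorem hasSum_neumannSeries_kProfile {t : ℝ} (ht : t ∈ Icc (-1) 1) :
    HasSum (fun j : ℕ => ε ^ j * convPow kProfile j t) (neumannSeries kProfile ε t) :=
  hasSum_neumannSeries continuousOn_kProfile integral_abs_kProfile_le
    (fun _ => abs_kProfile_le) (by linarith) ht

theorem abs_neumannSeries_kProfile_le {t : ℝ} (ht : t ∈ Icc (-1) 1) :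
    |neumannSeries kProfile ε t| ≤ (1 - |ε| * (16 / 15))⁻¹ * (4 * Real.pi)⁻¹ :=
  abs_neumannSeries_le continuousOn_kProfile integral_abs_kProfile_le
    (fun _ => abs_kProfile_le) (by linarith) ht

theorem continuousOn_neumannSeries_kProfile :
    ContinuousOn (neumannSeries kProfile ε) (Icc (-1) 1) :=
  continuousOn_neumannSeries continuousOn_kProfile integral_abs_kProfile_le
    (fun _ => abs_kProfile_le) (by linarith)

theorem neumannSeries_kProfile_eq {t : ℝ} (ht : t ∈ Icc (-1) 1) :
    neumannSeries kProfile ε t = kProfile t + ε * conv kProfile (neumannSeries kProfile ε) t :=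
  neumannSeries_eq continuousOn_kProfile integral_abs_kProfile_le
    (fun _ => abs_kProfile_le) (by linarith) ht

theorem zonalPotential_neumannSeries_kProfile_paneitz {φ : S3 → ℝ} (hφ : Smooth φ) (x : S3) :
    zonalPotential (neumannSeries kProfile ε) (paneitz φ + ε • φ) x = -φ x := by
  have hP := hφ.paneitz.continuous
  have hεφ := hφ.continuous.const_smul ε
  set W := zonalPotential (neumannSeries kProfile ε) (paneitz φ + ε • φ) with hW
  have hWcont : Continuous W :=
    continuous_zonalPotential (continuousOn_neumannSeries_kProfile hε) (hP.add hεφ)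
  have hfixed : ∀ a, (W + φ) a = ε * zonalPotential kProfile (W + φ) a := fun a => by
    have hresolvent : W a = _ := zonalPotential_neumannSeries continuousOn_kProfile
      integral_abs_kProfile_le (fun _ => abs_kProfile_le) (by linarith) (hP.add hεφ) a
    rw [zonalPotential_add continuousOn_kProfile hP hεφ, zonalPotential_smul,
      zonalPotential_kProfile_paneitz a hφ, ← hW] at hresolvent
    rw [Pi.add_apply, zonalPotential_add continuousOn_kProfile hWcont hφ.continuous, hresolvent]
    ring
  exact eq_neg_of_add_eq_zero_left <| congrFun (eq_zero_of_eq_mul_zonalPotential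
    continuousOn_kProfile integral_abs_kProfile_le (by linarith) (hWcont.add hφ.continuous)
    hfixed) x

theorem isGreenFunction_neumannSeries :
    IsGreenFunction (fun φ p => paneitz φ p + ε * φ p)
      (fun x y => -neumannSeries kProfile ε ⟪(x : R4), (y : R4)⟫_ℝ) where
  continuous :=
    (continuous_zonal (continuousOn_neumannSeries_kProfile hε) continuous_fst continuous_snd).neg
  integral_eq φ hφ x := by
    simp only [neg_mul, integral_neg]
    exact neg_eq_iff_eq_neg.2 (zonalPotential_neumannSeries_kProfile_paneitz hε hφ x)

end

end GreenFunction

section Monotonicity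

/-- The kernel `k (x · y)` is `L`-Lipschitz in each variable for the chordal distance. -/
def ZonalLipschitz (L : ℝ) (k : ℝ → ℝ) : Prop :=
  ∀ x x' y : S3, |k ⟪(x : R4), (y : R4)⟫_ℝ - k ⟪(x' : R4), (y : R4)⟫_ℝ| ≤ L * ‖(x : R4) - x'‖

variable {k g : ℝ → ℝ} {L L' M ε : ℝ}

theorem ZonalLipschitz.abs_sub_le (hk : ZonalLipschitz L k) (y z z' : S3) :
    |k ⟪(y : R4), (z : R4)⟫_ℝ - k ⟪(y : R4), (z' : R4)⟫_ℝ| ≤ L * ‖(z : R4) - z'‖ := by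
  rw [real_inner_comm, real_inner_comm (z' : R4)]
  exact hk z z' y

theorem ZonalLipschitz.continuousOn (hk : ZonalLipschitz L k) :
    ContinuousOn k (Icc (-1) 1) := by
  have hlip : LipschitzWith L.toNNReal fun x : S3 => k ⟪(north : R4), (x : R4)⟫_ℝ :=
    .of_dist_le' fun x x' =>
      (hk.abs_sub_le north x x').trans_eq (by rw [Subtype.dist_eq, dist_eq_norm])
  refine continuousOn_iff_continuous_domRestrict.2
    ((hlip.continuous.comp continuous_spherePoint).congr fun t => ?_)
  simp only [Function.comp_apply, inner_north_spherePoint, domRestrict_apply]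

theorem ZonalLipschitz.abs_zonalPotential_sub_le (hk : ZonalLipschitz L k) {h : S3 → ℝ}
    (hh : Continuous h) (hM : ∀ y, |h y| ≤ M) (x x' : S3) :
    |zonalPotential k h x - zonalPotential k h x'| ≤
      2 * Real.pi ^ 2 * (L * M) * ‖(x : R4) - x'‖ := by
  have hdiff : zonalPotential k h x - zonalPotential k h x' = ∫ y : S3,
      (k ⟪(x : R4), (y : R4)⟫_ℝ - k ⟪(x' : R4), (y : R4)⟫_ℝ) * h y ∂sphereMeasure := by
    simp only [sub_mul]
    exact (integral_sub (integrable_sphereMeasure (continuous_zonal_mul hk.continuousOn hh x))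
      (integrable_sphereMeasure (continuous_zonal_mul hk.continuousOn hh x'))).symm
  rw [hdiff, ← Real.norm_eq_abs]
  refine (norm_integral_le_of_norm_le_const (C := L * ‖(x : R4) - x'‖ * M)
    (.of_forall fun y => ?_)).trans_eq ?_
  · rw [norm_mul]
    exact mul_le_mul (hk x x' y) (hM y) (abs_nonneg _) ((abs_nonneg _).trans (hk x x' y))
  · rw [sphereMeasure_real_univ]
    ring

theorem ZonalLipschitz.conv_of_abs_le (hk : ZonalLipschitz L k) (hg : ContinuousOn g (Icc (-1) 1))
    (hM : ∀ t ∈ Icc (-1) 1, |g t| ≤ M) :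
    ZonalLipschitz (2 * Real.pi ^ 2 * (L * M)) (conv k g) := fun x x' y => by
  simp only [conv_inner_eq_zonalPotential]
  exact hk.abs_zonalPotential_sub_le (continuous_zonal hg continuous_id continuous_const)
    (fun z => hM _ (inner_mem_Icc z y)) x x'

theorem zonalPotential_comp_rot (R : R4 ≃ₗᵢ[ℝ] R4) (k : ℝ → ℝ) (h : S3 → ℝ) (x : S3) :
    zonalPotential k (h ∘ rot R) x = zonalPotential k h (rot R x) := by
  have hembed : MeasurableEmbedding (rot R) :=
    (Continuous.subtype_mk (R.continuous.comp continuous_subtype_val) _).measurableEmbedding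
      fun _ _ hab => Subtype.ext (R.injective (congrArg Subtype.val hab))
  rw [zonalPotential, zonalPotential, ← (rot_measurePreserving R).integral_comp hembed
    fun y => k ⟪(rot R x : R4), (y : R4)⟫_ℝ * h y]
  simp only [rot, R.inner_map_map, Function.comp_apply]

theorem norm_sub_reflection_mul {E : Type*} [NormedAddCommGroup E] [InnerProductSpace ℝ E]
    (v x : E) : ‖x - (ℝ ∙ v)ᗮ.reflection x‖ * ‖v‖ = 2 * |⟪x, v⟫_ℝ| := by
  rcases eq_or_ne v 0 with rfl | hv
  · simp
  have hn : ‖v‖ ≠ 0 := norm_ne_zero_iff.2 hv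
  rw [Submodule.reflection_orthogonal_apply, Submodule.reflection_singleton_apply, sub_neg_eq_add,
    add_sub_cancel, ← Nat.cast_smul_eq_nsmul ℝ, norm_smul, norm_smul, real_inner_comm]
  simp only [Real.norm_eq_abs, abs_div, RCLike.ofReal_real_eq_id, id, Nat.cast_ofNat, abs_two,
    abs_of_nonneg (sq_nonneg ‖v‖)]
  field_simp

theorem ZonalLipschitz.abs_zonalPotential_le_of_odd (hk : ZonalLipschitz L k) {h : S3 → ℝ}
    (hh : Continuous h) (hM : ∀ y, |h y| ≤ M) {R : R4 ≃ₗᵢ[ℝ] R4} (hodd : h ∘ rot R = -h) (x : S3) :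
    |zonalPotential k h x| ≤ Real.pi ^ 2 * (L * M) * ‖(x : R4) - rot R x‖ := by
  have hmirror : zonalPotential k h (rot R x) = -zonalPotential k h x := by
    rw [← zonalPotential_comp_rot, hodd, ← neg_one_smul ℝ h, zonalPotential_smul, neg_one_mul]
  have hbound := hk.abs_zonalPotential_sub_le hh hM x (rot R x)
  rw [hmirror, sub_neg_eq_add, ← two_mul, abs_mul, abs_two] at hbound
  linear_combination hbound / 2

-- The difference of the two zonal functions centred at `z` and `z'` is odd under the reflection
-- exchanging `z` and `z'`, which moves `x` by a multiple of `⟪x, z - z'⟫`.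
theorem ZonalLipschitz.abs_conv_inner_sub_le (hk : ZonalLipschitz L k) (hg : ZonalLipschitz L' g)
    (x z z' : S3) :
    |conv k g ⟪(x : R4), (z : R4)⟫_ℝ - conv k g ⟪(x : R4), (z' : R4)⟫_ℝ| ≤
      2 * Real.pi ^ 2 * (L * L') * |⟪(x : R4), (z : R4)⟫_ℝ - ⟪(x : R4), (z' : R4)⟫_ℝ| := by
  let R : R4 ≃ₗᵢ[ℝ] R4 := (ℝ ∙ ((z : R4) - z'))ᗮ.reflection
  have hRz : R z = z' := Submodule.reflection_sub (by rw [norm_coe, norm_coe])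
  have hRz' : R z' = z := by
    rw [← hRz]
    exact Submodule.reflection_reflection _ _
  let D (w : S3) : S3 → ℝ := fun y => g ⟪(y : R4), (w : R4)⟫_ℝ
  have hD (w : S3) : Continuous (D w) :=
    continuous_zonal hg.continuousOn continuous_id continuous_const
  have hodd : (D z - D z') ∘ rot R = -(D z - D z') := by
    funext y
    have hz : ⟪R y, (z : R4)⟫_ℝ = ⟪(y : R4), (z' : R4)⟫_ℝ := by rw [← hRz', R.inner_map_map]
    have hz' : ⟪R y, (z' : R4)⟫_ℝ = ⟪(y : R4), (z : R4)⟫_ℝ := by rw [← hRz, R.inner_map_map]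
    simp only [D, Function.comp_apply, Pi.sub_apply, Pi.neg_apply, rot, hz, hz', neg_sub]
  have hchord : ‖(x : R4) - rot R x‖ * ‖(z : R4) - z'‖ =
      2 * |⟪(x : R4), (z : R4)⟫_ℝ - ⟪(x : R4), (z' : R4)⟫_ℝ| := by
    rw [← inner_sub_right]
    exact norm_sub_reflection_mul _ _
  rw [conv_inner_eq_zonalPotential, conv_inner_eq_zonalPotential,
    ← zonalPotential_sub hk.continuousOn (hD z) (hD z')]
  linear_combination hk.abs_zonalPotential_le_of_odd ((hD z).sub (hD z'))
    (fun y => hg.abs_sub_le y z z') hodd x + Real.pi ^ 2 * (L * L') * hchord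

theorem kProfile_inner (x y : S3) :
    kProfile ⟪(x : R4), (y : R4)⟫_ℝ = (8 * Real.pi)⁻¹ * ‖(x : R4) - y‖ := by
  have hchord : ‖(x : R4) - y‖ = √2 * √(1 - ⟪(x : R4), (y : R4)⟫_ℝ) := by
    rw [← Real.sqrt_mul zero_le_two, ← Real.sqrt_sq (norm_nonneg ((x : R4) - y)),
      norm_sub_sq_real, norm_coe, norm_coe]
    ring_nf
  have hsq : √2 * √2 = 2 := Real.mul_self_sqrt zero_le_two
  rw [hchord, kProfile]
  field_simp
  linear_combination (-4 * √(1 - ⟪(x : R4), (y : R4)⟫_ℝ)) * hsq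

theorem zonalLipschitz_kProfile : ZonalLipschitz (8 * Real.pi)⁻¹ kProfile := fun x x' y => by
  have h := abs_norm_sub_norm_le ((x : R4) - y) ((x' : R4) - y)
  rw [sub_sub_sub_cancel_right] at h
  rw [kProfile_inner, kProfile_inner, ← mul_sub, abs_mul, abs_of_pos (by positivity)]
  gcongr

theorem zonalLipschitz_neumannSeries_kProfile (hε : |ε| ≤ 1 / 4) :
    ZonalLipschitz (4 * Real.pi)⁻¹ (neumannSeries kProfile ε) := fun x x' y => by
  have hε' : |ε| < 15 / 16 := by linarith
  have hM : ∀ t ∈ Icc (-1) 1, |neumannSeries kProfile ε t| ≤ 2 * (4 * Real.pi)⁻¹ := fun t ht =>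
    (abs_neumannSeries_kProfile_le hε' ht).trans <| by
      gcongr
      exact inv_le_of_inv_le₀ two_pos (by linarith)
  have hconv := zonalLipschitz_kProfile.conv_of_abs_le
    (continuousOn_neumannSeries_kProfile hε') hM x x' y
  have hpi := Real.pi_le_four
  rw [neumannSeries_kProfile_eq hε' (inner_mem_Icc x y),
    neumannSeries_kProfile_eq hε' (inner_mem_Icc x' y)]
  calc _ = |(kProfile ⟪(x : R4), (y : R4)⟫_ℝ - kProfile ⟪(x' : R4), (y : R4)⟫_ℝ) +
          ε * (conv kProfile (neumannSeries kProfile ε) ⟪(x : R4), (y : R4)⟫_ℝ -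
            conv kProfile (neumannSeries kProfile ε) ⟪(x' : R4), (y : R4)⟫_ℝ)| := by
        congr 1
        ring
    _ ≤ (8 * Real.pi)⁻¹ * ‖(x : R4) - x'‖ + 1 / 4 *
          (2 * Real.pi ^ 2 * ((8 * Real.pi)⁻¹ * (2 * (4 * Real.pi)⁻¹)) * ‖(x : R4) - x'‖) := by
        refine (abs_add_le _ _).trans (add_le_add (zonalLipschitz_kProfile x x' y) ?_)
        rw [abs_mul]
        exact mul_le_mul hε hconv (abs_nonneg _) (by norm_num)
    _ = ((8 * Real.pi)⁻¹ + 1 / 32) * ‖(x : R4) - x'‖ := by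
        field_simp
        ring
    _ ≤ (4 * Real.pi)⁻¹ * ‖(x : R4) - x'‖ := by
        gcongr
        field_simp
        linarith

theorem le_kProfile_sub_kProfile {t t' : ℝ} (ht : -1 ≤ t) (htt' : t ≤ t') (ht' : t' ≤ 1) :
    (16 * Real.pi)⁻¹ * (t' - t) ≤ kProfile t - kProfile t' := by
  have hle : √(1 - t) ≤ √2 := Real.sqrt_le_sqrt (by linarith)
  have hle' : √(1 - t') ≤ √2 := Real.sqrt_le_sqrt (by linarith)
  have hanti : √(1 - t') ≤ √(1 - t) := Real.sqrt_le_sqrt (by linarith)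
  have hdiff : t' - t = (√(1 - t) - √(1 - t')) * (√(1 - t) + √(1 - t')) := by
    linear_combination Real.sq_sqrt (show 0 ≤ 1 - t' by linarith) -
      Real.sq_sqrt (show 0 ≤ 1 - t by linarith)
  calc (16 * Real.pi)⁻¹ * (t' - t)
      ≤ (16 * Real.pi)⁻¹ * ((√(1 - t) - √(1 - t')) * (√2 + √2)) := by
        rw [hdiff]
        have := sub_nonneg.2 hanti
        gcongr
    _ = kProfile t - kProfile t' := by
        rw [kProfile, kProfile]
        field_simp
        linear_combination (8 * (√(1 - t) - √(1 - t'))) * Real.sq_sqrt (zero_le_two (α := ℝ))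

theorem strictAntiOn_neumannSeries_kProfile (hε : |ε| ≤ 1 / 4) :
    StrictAntiOn (neumannSeries kProfile ε) (Icc (-1) 1) := fun t ht t' ht' htt' => by
  have hε' : |ε| < 15 / 16 := by linarith
  have hpos : 0 < t' - t := sub_pos.2 htt'
  rw [neumannSeries_kProfile_eq hε' ht, neumannSeries_kProfile_eq hε' ht']
  have hconv : |conv kProfile (neumannSeries kProfile ε) t' -
      conv kProfile (neumannSeries kProfile ε) t| ≤
        2 * Real.pi ^ 2 * ((8 * Real.pi)⁻¹ * (4 * Real.pi)⁻¹) * |t' - t| := by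
    obtain ⟨z, rfl⟩ := exists_inner_north_eq ht
    obtain ⟨z', rfl⟩ := exists_inner_north_eq ht'
    exact zonalLipschitz_kProfile.abs_conv_inner_sub_le
      (zonalLipschitz_neumannSeries_kProfile hε) north z' z
  have hperturb : ε * (conv kProfile (neumannSeries kProfile ε) t' -
      conv kProfile (neumannSeries kProfile ε) t) < kProfile t - kProfile t' := by
    calc _ ≤ |ε| * |conv kProfile (neumannSeries kProfile ε) t' -
            conv kProfile (neumannSeries kProfile ε) t| := (le_abs_self _).trans (abs_mul _ _).le
      _ ≤ 1 / 4 * (2 * Real.pi ^ 2 * ((8 * Real.pi)⁻¹ * (4 * Real.pi)⁻¹) * |t' - t|) := by gcongr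
      _ = 1 / 64 * (t' - t) := by
        rw [abs_of_pos hpos]
        field_simp
        ring
      _ < (16 * Real.pi)⁻¹ * (t' - t) := by
        gcongr
        rw [one_div]
        exact inv_strictAnti₀ (by positivity) (by linarith [Real.pi_lt_four])
      _ ≤ kProfile t - kProfile t' := le_kProfile_sub_kProfile ht.1 htt'.le ht'.2
  linarith

end Monotonicity

end PaneitzSphere

end

theorem lemma4p1_general {ε : ℝ} (hε : |ε| ≤ 1 / 4) :
    ∃ (G : S3 → S3 → ℝ) (kε : ℝ → ℝ),
      IsGreenFunction (fun φ p => paneitz φ p + ε * φ p) G ∧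
      (∀ G' : S3 → S3 → ℝ,
        IsGreenFunction (fun φ p => paneitz φ p + ε * φ p) G' → G' = G) ∧
      (∀ x y : S3, kε ⟪(x : R4), (y : R4)⟫_ℝ = -G x y) ∧
      (∀ t ∈ Icc (-1 : ℝ) 1, HasSum (fun j : ℕ => ε ^ j * convPow kProfile j t) (kε t)) ∧
      StrictAntiOn kε (Icc (-1) 1) := by
  have hε' : |ε| < 15 / 16 := by linarith
  have hG := isGreenFunction_neumannSeries hε'
  exact ⟨_, neumannSeries kProfile ε, hG, fun _ hG' => hG'.unique hε' hG,
    fun _ _ => (neg_neg _).symm, fun _ => hasSum_neumannSeries_kProfile hε',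
    strictAntiOn_neumannSeries_kProfile hε⟩

theorem lemma4p1 :
    ∃ ε₀ : ℝ, 0 < ε₀ ∧ ∀ ε : ℝ, 0 < ε → ε < ε₀ →
      ∃ (G : S3 → S3 → ℝ) (kε : ℝ → ℝ),
        -- `G` is the Green's function of `P + ε`, and it is the only one
        IsGreenFunction (fun φ p => paneitz φ p + ε * φ p) G ∧
        (∀ G' : S3 → S3 → ℝ,
          IsGreenFunction (fun φ p => paneitz φ p + ε * φ p) G' → G' = G) ∧
        -- `kε` is the profile of the invariant kernel `-G`
        (∀ x y : S3, kε ⟪(x : R4), (y : R4)⟫_ℝ = -G x y) ∧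
        -- the Neumann series
        (∀ t ∈ Icc (-1 : ℝ) 1, HasSum (fun j : ℕ => ε ^ j * convPow kProfile j t) (kε t)) ∧
        StrictAntiOn kε (Icc (-1) 1) := by
  exact ⟨1 / 4, by norm_num, fun _ hpos hlt =>
    lemma4p1_general ((abs_of_pos hpos).trans_le hlt.le)⟩
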